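/- Model. $M$ independent records $W_1,\dots,W_M$, each uniform on $\mathbb F_q^L$, are replicated on each of $N$ servers. A user who wants $W_\theta$ ($\theta$ uniform on $\{1,\dots,M\}$, independent of the records) chooses random resources $S$, independent of $(\theta,W_1,\dots,W_M)$, and sends to server $j$ a query $Q^{(j)}_\theta$ determined by $(\theta,S)$; server $j$ returns an answer $A^{(j)}_\theta$ determined by $Q^{(j)}_\theta$ and $W_1,\dots,W_M$. All alphabets are finite. This is a $T$-PIR scheme if $H(W_\theta\mid A^{[N]}_\theta,Q^{[N]}_\theta,S,\theta)=0$ and $I(\theta;Q^\Gamma_\theta,A^\Gamma_\theta,W_{[M]})=0$ for every $\Gamma\subseteq[N]$ with $|\Gamma|=T$. Its rate is $H(W_\theta)/\sum_{i=1}^N H(A^{(i)}_\theta)$. It is capacity-achieving if its rate is the largest one among all $T$-PIR schemes with the same $N$ and $M$ (over all finite fields and all $L\ge1$). It is linear over $\mathbb F_q$ if every answer is a vector over $\mathbb F_q$ that, for each fixed query, depends $\mathbb F_q$-linearly on the records; $L$ is then its sub-packetization. Theorem. Let $1\le T<N$, $n=N/\gcd(N,T)$, $t=T/\gcd(N,T)$,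 and suppose $\mu=\min\{t,n-t\}>1$. If $$M\ \ge\ 2+\lceil \log_\mu\log_2 N\rceil ,$$ then there is a linear capacity-achieving $T$-PIR scheme for $N$ servers and $M$ records over the binary field $\mathbb F_2$ with sub-packetization $L=Nn^{M-2}$, and its rate is $\frac{1-T/N}{1-(T/N)^M}$. This sub-packetization is optimal: $Nn^{M-2}$ is the smallest sub-packetization of a linear capacity-achieving $T$-PIR scheme for $N$ servers and $M$ records over any finite field. -/

import Mathlib

open Finset

/-! ## Shannon entropy of finite random variables

`p : Ω → ℝ` is a probability mass function on a finite sample space `Ω`, and a random variable is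
a function on `Ω` with values in a finite type.  Entropies are in nats; every notion below is
either a ratio of entropies or the vanishing of one, so the base of the logarithm is irrelevant. -/

/-- `P(X = x)`. -/
noncomputable def probOf {Ω α : Type*} [Fintype Ω] (p : Ω → ℝ) (X : Ω → α) (x : α) : ℝ :=
  open Classical in ∑ ω, if X ω = x then p ω else 0

/-- Shannon entropy `H(X) = - ∑ₓ P(X = x) log P(X = x)`. -/
noncomputable def entropy {Ω α : Type*} [Fintype Ω] [Fintype α] (p : Ω → ℝ) (X : Ω → α) : ℝ :=
  ∑ x, Real.negMulLog (probOf p X x)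

/-- Conditional entropy `H(X | Y) = H(X, Y) - H(Y)`. -/
noncomputable def condEntropy {Ω α β : Type*} [Fintype Ω] [Fintype α] [Fintype β]
    (p : Ω → ℝ) (X : Ω → α) (Y : Ω → β) : ℝ :=
  entropy p (fun ω => (X ω, Y ω)) - entropy p Y

/-- Mutual information `I(X ; Y) = H(X) + H(Y) - H(X, Y)`. -/
noncomputable def mutualInfo {Ω α β : Type*} [Fintype Ω] [Fintype α] [Fintype β]
    (p : Ω → ℝ) (X : Ω → α) (Y : Ω → β) : ℝ :=
  entropy p X + entropy p Y - entropy p (fun ω => (X ω, Y ω))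

/-! ## Private information retrieval from replicated servers -/

/-- The data of a retrieval scheme for `M` records, each a vector of length `L` over `F`, all of
them stored on each of `N` servers: the random resources of the user with their distribution,
the query function and the answer functions. -/
structure PIRScheme (F : Type) (N M L : ℕ) where
  /-- the set of values of the random resources of the user -/
  Rand : Type
  [randFintype : Fintype Rand]
  /-- the distribution of the random resources -/
  prob : Rand → ℝ
  prob_nonneg : ∀ s, 0 ≤ prob s
  prob_sum : ∑ s, prob s = 1
  /-- the query alphabet of each server -/
  Query : Fin N → Type
  [queryFintype : ∀ j, Fintype (Query j)]
  /-- the answer alphabet of each server -/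
  Answer : Fin N → Type
  [answerFintype : ∀ j, Fintype (Answer j)]
  /-- `que θ s j` is the query sent to server `j` -/
  que : Fin M → Rand → (j : Fin N) → Query j
  /-- `ans j x w` is the answer of server `j` to the query `x` when the records are `w` -/
  ans : (j : Fin N) → Query j → (Fin M → Fin L → F) → Answer j

namespace PIRScheme

attribute [instance] PIRScheme.randFintype PIRScheme.queryFintype PIRScheme.answerFintype

variable {F : Type} {N M L : ℕ}

/-- The sample space: the index `θ` of the desired record, the random resources of the user, and
the `M` records. -/
abbrev Sample (S : PIRScheme F N M L) : Type := Fin M × S.Rand × (Fin M → Fin L → F)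

/-- The joint distribution: `θ`, the random resources and the records are independent, `θ` is
uniform on the `M` indices, and the records are independent and uniform on `F ^ L`. -/
noncomputable def law [Fintype F] (S : PIRScheme F N M L) (ω : S.Sample) : ℝ :=
  (M : ℝ)⁻¹ * S.prob ω.2.1 * ((Fintype.card (Fin M → Fin L → F) : ℕ) : ℝ)⁻¹

/-- The index `θ` of the desired record. -/
def index (S : PIRScheme F N M L) (ω : S.Sample) : Fin M := ω.1

/-- The random resources of the user. -/
def resources (S : PIRScheme F N M L) (ω : S.Sample) : S.Rand := ω.2.1

/-- All the records. -/
def records (S : PIRScheme F N M L) (ω : S.Sample) : Fin M → Fin L → F := ω.2.2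

/-- The desired record `W_θ`. -/
def desired (S : PIRScheme F N M L) (ω : S.Sample) : Fin L → F := S.records ω (S.index ω)

/-- The query received by server `j`. -/
def query (S : PIRScheme F N M L) (j : Fin N) (ω : S.Sample) : S.Query j :=
  S.que (S.index ω) (S.resources ω) j

/-- The answer of server `j`. -/
def answer (S : PIRScheme F N M L) (j : Fin N) (ω : S.Sample) : S.Answer j :=
  S.ans j (S.query j ω) (S.records ω)

/-- Correctness: `H(W_θ | A^[N], Q^[N], S, θ) = 0`. -/
def IsCorrect [Fintype F] (S : PIRScheme F N M L) : Prop :=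
  condEntropy S.law S.desired
    (fun ω => ((fun j => S.answer j ω), (fun j => S.query j ω), S.resources ω, S.index ω)) = 0

/-- `T`-privacy: `I(θ ; Q^Γ, A^Γ, W_[M]) = 0` for every set `Γ` of `T` servers. -/
def IsPrivate [Fintype F] (S : PIRScheme F N M L) (T : ℕ) : Prop :=
  ∀ Γ : Finset (Fin N), #Γ = T →
    mutualInfo S.law S.index
      (fun ω => ((fun j : Γ => S.query j ω), (fun j : Γ => S.answer j ω), S.records ω)) = 0

/-- A `T`-PIR scheme: correct and `T`-private. -/
def IsTPIR [Fintype F] (S : PIRScheme F N M L) (T : ℕ) : Prop :=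
  S.IsCorrect ∧ S.IsPrivate T

/-- The rate `H(W_θ) / ∑ᵢ H(A^(i))`. -/
noncomputable def rate [Fintype F] (S : PIRScheme F N M L) : ℝ :=
  entropy S.law S.desired / ∑ i, entropy S.law (S.answer i)

/-- A linear scheme over `F`: the answer of each server is a vector over `F` which, for each
query, depends `F`-linearly on the records. -/
def IsLinear [Field F] (S : PIRScheme F N M L) : Prop :=
  ∃ (d : Fin N → ℕ) (e : ∀ j, S.Answer j ≃ (Fin (d j) → F)),
    ∀ (j : Fin N) (x : S.Query j), IsLinearMap F (fun w => e j (S.ans j x w))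

end PIRScheme

/-- The rates of all (not necessarily linear) `T`-PIR schemes for `N` servers and `M` records, the
records being vectors of any positive length over any finite field. -/
def achievableRates (N T M : ℕ) : Set ℝ :=
  {r | ∃ (F : Type) (_ : Field F) (_ : Fintype F) (L : ℕ) (S : PIRScheme F N M L),
    0 < L ∧ S.IsTPIR T ∧ S.rate = r}

/-- A capacity-achieving `T`-PIR scheme: its rate is the largest (in particular the supremum) of
the rates of all `T`-PIR schemes with the same numbers of servers and of records. -/
def PIRScheme.IsCapacityAchieving {F : Type} [Fintype F] {N M L : ℕ} (S : PIRScheme F N M L)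
    (T : ℕ) : Prop :=
  S.IsTPIR T ∧ IsGreatest (achievableRates N T M) S.rate

/-- The sub-packetizations of the linear capacity-achieving `T`-PIR schemes for `N` servers and
`M` records, over any finite field. The sub-packetization of a linear scheme over `F` is the
number `L` of symbols of `F` in each record. -/
def linearSubpacketizations (N T M : ℕ) : Set ℕ :=
  {L | 0 < L ∧ ∃ (F : Type) (_ : Field F) (_ : Fintype F) (S : PIRScheme F N M L),
    S.IsLinear ∧ S.IsCapacityAchieving T}

/-! ### Shannon entropy on finite sample spaces. -/

section Entropy

variable {Ω α β γ : Type*} [Fintype Ω]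

/-! Write d = gcd(N,T), so N = dn and T = dt.

Converse. For fixed queries, let `residual` be the conditional entropy of the answers of a set of
servers given a set of records. As a function of the set of servers it is submodular. Let c_k be the
mean residual of all answers given the first k records, when the next record is desired. Decoding
that record removes L log q; privacy for T servers allows the desired index to be changed; Han's
inequality bounds the residual of all servers by N/T times the average over T servers. Hence N(c_k -
L log q) ≥ T c_{k+1}, and iteration gives the capacity bound `mul_sum_pow_le_sum_entropy`.

Optimality of L. If the bound is attained, every step is an equality for every query of positive
probability. Equality in Han's inequality, with equal residuals on all sets of T servers, makes the
greedy base vector constant (this needs T < N), so c_k - L log q = T g and c_{k+1} = N g, where g is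
a difference of two residuals (`residual_succ_eq`). In a linear scheme residuals are integer
multiples of log q. The resulting integer recurrence, with n and t coprime, forces N n^(M-2) to
divide L (`pow_dvd_of_recurrence`, `mul_pow_dvd_of_isLinear`).

Construction. Each server returns sums indexed by nonempty sets of records. For a set Λ of k
undesired records, the interference is a codeword of an array code with one block of β_k =
`blockSize` bits per server: α_{j,k} of them are returned bare by server j, and the other α_{j,k+1}
are added to symbols of the desired record in sums indexed by Λ ∪ {θ}. The bare parts must determine
the codeword, while any T full blocks must be independent. Such a code comes from a Reed-Solomon
code over the field with 2^β_k elements read over the binary field, with information set chosen by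
Rado's theorem (`exists_binary_array_code`). The only demand on the field is N ≤ 2^β_k, which
follows from the hypothesis on M because β_k ≥ μ^(M-2). The loads α_{j,k} need not be equal across
servers: they are roundings of a possibly non-integral average (`exists_serverLoads`), which is what
permits so small an L. Independent random changes of basis, one per record, hide the pattern
(`exists_scheme_of_pattern`). -/

theorem probOf_nonneg {p : Ω → ℝ} (hp : ∀ ω, 0 ≤ p ω) (X : Ω → α) (x : α) :
    0 ≤ probOf p X x := by
  unfold probOf
  refine Finset.sum_nonneg fun ω _ => ?_
  split_ifs
  exacts [hp ω, le_rfl]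

theorem le_probOf_self {p : Ω → ℝ} (hp : ∀ ω, 0 ≤ p ω) (X : Ω → α) (ω : Ω) :
    p ω ≤ probOf p X (X ω) := by
  classical
  unfold probOf
  have := Finset.single_le_sum (f := fun ω' => if X ω' = X ω then p ω' else 0)
    (fun ω' _ => by split_ifs; exacts [hp ω', le_rfl]) (Finset.mem_univ ω)
  simpa using this

theorem sum_probOf_mul [Fintype α] (p : Ω → ℝ) (X : Ω → α) (f : α → ℝ) :
    ∑ x, probOf p X x * f x = ∑ ω, p ω * f (X ω) := by
  classical
  simp only [probOf, Finset.sum_mul]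
  rw [Finset.sum_comm]
  refine Finset.sum_congr rfl fun ω _ => ?_
  simp [ite_mul]

theorem sum_probOf [Fintype α] (p : Ω → ℝ) (X : Ω → α) :
    ∑ x, probOf p X x = ∑ ω, p ω := by
  simpa using sum_probOf_mul p X fun _ => 1

theorem sum_probOf_prod_right [Fintype β] (p : Ω → ℝ) (X : Ω → α) (Y : Ω → β) (x : α) :
    ∑ y, probOf p (fun ω => (X ω, Y ω)) (x, y) = probOf p X x := by
  classical
  simp only [probOf, Prod.mk.injEq]
  rw [Finset.sum_comm]
  refine Finset.sum_congr rfl fun ω _ => ?_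
  by_cases h : X ω = x <;> simp [h]

theorem sum_probOf_prod_left [Fintype α] (p : Ω → ℝ) (X : Ω → α) (Y : Ω → β) (y : β) :
    ∑ x, probOf p (fun ω => (X ω, Y ω)) (x, y) = probOf p Y y := by
  classical
  simp only [probOf, Prod.mk.injEq]
  rw [Finset.sum_comm]
  refine Finset.sum_congr rfl fun ω _ => ?_
  by_cases h : Y ω = y <;> simp [h]

theorem entropy_eq_sum [Fintype α] (p : Ω → ℝ) (X : Ω → α) :
    entropy p X = ∑ ω, p ω * -Real.log (probOf p X (X ω)) := by
  rw [← sum_probOf_mul p X fun x => -Real.log (probOf p X x)]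
  simp [entropy, Real.negMulLog]

/-- The fibre of Y through an outcome is contained in the fibre of X through it. -/
theorem probOf_le_of_determines {p : Ω → ℝ} (hp : ∀ ω, 0 ≤ p ω) {X : Ω → α} {Y : Ω → β}
    (h : ∀ ω ω', Y ω = Y ω' → X ω = X ω') (ω : Ω) :
    probOf p Y (Y ω) ≤ probOf p X (X ω) := by
  classical
  unfold probOf
  refine Finset.sum_le_sum fun ω' _ => ?_
  by_cases h' : Y ω' = Y ω
  · simp [h', h _ _ h']
  · rw [if_neg h']
    split_ifs
    exacts [hp ω', le_rfl]

theorem entropy_le_of_determines [Fintype α] [Fintype β] {p : Ω → ℝ} (hp : ∀ ω, 0 ≤ p ω)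
    {X : Ω → α} {Y : Ω → β} (h : ∀ ω ω', Y ω = Y ω' → X ω = X ω') :
    entropy p X ≤ entropy p Y := by
  rw [entropy_eq_sum, entropy_eq_sum]
  refine Finset.sum_le_sum fun ω _ => ?_
  rcases (hp ω).eq_or_lt with h0 | h0
  · simp [← h0]
  · refine mul_le_mul_of_nonneg_left (neg_le_neg (Real.log_le_log ?_ ?_)) h0.le
    · exact h0.trans_le (le_probOf_self hp Y ω)
    · exact probOf_le_of_determines hp h ω

theorem entropy_eq_of_kernel [Fintype α] [Fintype β] {p : Ω → ℝ} (hp : ∀ ω, 0 ≤ p ω)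
    {X : Ω → α} {Y : Ω → β} (h : ∀ ω ω', Y ω = Y ω' ↔ X ω = X ω') :
    entropy p X = entropy p Y :=
  le_antisymm (entropy_le_of_determines hp fun ω ω' => (h ω ω').1)
    (entropy_le_of_determines hp fun ω ω' => (h ω ω').2)

theorem sub_le_mul_log_sub_log {a b : ℝ} (ha : 0 ≤ a) (hb : 0 ≤ b) (hab : b = 0 → a = 0) :
    a - b ≤ a * (Real.log a - Real.log b) := by
  rcases ha.eq_or_lt with rfl | ha
  · simpa using hb
  have hb' : 0 < b := hb.lt_of_ne fun h => ha.ne' (hab h.symm)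
  have := Real.log_le_sub_one_of_pos (div_pos hb' ha)
  rw [Real.log_div hb'.ne' ha.ne'] at this
  have h2 := mul_le_mul_of_nonneg_left this ha.le
  have h3 : a * (b / a - 1) = b - a := by field_simp
  nlinarith

theorem eq_of_mul_log_sub_log_eq {a b : ℝ} (ha : 0 ≤ a) (hb : 0 ≤ b) (hab : b = 0 → a = 0)
    (h : a * (Real.log a - Real.log b) = a - b) : a = b := by
  rcases ha.eq_or_lt with rfl | ha
  · simp at h; exact h.symm
  have hb' : 0 < b := hb.lt_of_ne fun h => ha.ne' (hab h.symm)
  by_contra hne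
  have hne' : b / a ≠ 1 := fun h => hne ((div_eq_one_iff_eq ha.ne').1 h).symm
  have := Real.log_lt_sub_one_of_pos (div_pos hb' ha) hne'
  rw [Real.log_div hb'.ne' ha.ne'] at this
  have h2 := mul_lt_mul_of_pos_left this ha
  have h3 : a * (b / a - 1) = b - a := by field_simp
  nlinarith

/-- Gibbs' inequality. -/
theorem gibbs_nonneg {ι : Type*} [Fintype ι] {p q : ι → ℝ} (hp : ∀ i, 0 ≤ p i)
    (hq : ∀ i, 0 ≤ q i) (hpq : ∀ i, q i = 0 → p i = 0) (hsum : ∑ i, q i ≤ ∑ i, p i) :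
    0 ≤ ∑ i, p i * (Real.log (p i) - Real.log (q i)) := by
  have := Finset.sum_le_sum fun i (_ : i ∈ Finset.univ) =>
    sub_le_mul_log_sub_log (hp i) (hq i) (hpq i)
  rw [Finset.sum_sub_distrib] at this
  linarith

/-- The equality case of Gibbs' inequality. -/
theorem eq_of_gibbs_eq_zero {ι : Type*} [Fintype ι] {p q : ι → ℝ} (hp : ∀ i, 0 ≤ p i)
    (hq : ∀ i, 0 ≤ q i) (hpq : ∀ i, q i = 0 → p i = 0) (hsum : ∑ i, q i ≤ ∑ i, p i)
    (h : ∑ i, p i * (Real.log (p i) - Real.log (q i)) = 0) (i : ι) : p i = q i := by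
  have hle := fun i (_ : i ∈ Finset.univ) => sub_le_mul_log_sub_log (hp i) (hq i) (hpq i)
  have hs := Finset.sum_le_sum hle
  rw [Finset.sum_sub_distrib] at hs
  have heq := (Finset.sum_eq_sum_iff_of_le hle).1
    (by rw [Finset.sum_sub_distrib]; linarith) i (Finset.mem_univ i)
  exact eq_of_mul_log_sub_log_eq (hp i) (hq i) (hpq i) heq.symm

theorem entropy_le_log_card [Fintype α] {p : Ω → ℝ} (hp : ∀ ω, 0 ≤ p ω) (hp1 : ∑ ω, p ω = 1)
    (X : Ω → α) : entropy p X ≤ Real.log (Fintype.card α) := by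
  have hne : Nonempty α := by
    by_contra hne
    rw [not_nonempty_iff] at hne
    have := sum_probOf p X
    simp [hp1] at this
  have hc : (0 : ℝ) < Fintype.card α := by exact_mod_cast Fintype.card_pos
  have := gibbs_nonneg (p := probOf p X) (q := fun _ => (Fintype.card α : ℝ)⁻¹)
    (probOf_nonneg hp X) (fun _ => by positivity) (fun _ h => absurd h (by positivity))
    (by rw [sum_probOf, hp1]; simp [hc.ne'])
  simp only [Real.log_inv, mul_sub, Finset.sum_sub_distrib, mul_neg, Finset.sum_neg_distrib,
    ← Finset.sum_mul, sum_probOf, hp1] at this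
  simp only [entropy, Real.negMulLog, neg_mul, Finset.sum_neg_distrib]
  linarith

/-- Gibbs' inequality, comparing the joint law with the law P(x,z)P(y,z)/P(z) under which X and Y
are conditionally independent given Z. -/
theorem entropy_submodular [Fintype α] [Fintype β] [Fintype γ] {p : Ω → ℝ} (hp : ∀ ω, 0 ≤ p ω)
    (X : Ω → α) (Y : Ω → β) (Z : Ω → γ) :
    entropy p (fun ω => (X ω, Y ω, Z ω)) + entropy p Z ≤
      entropy p (fun ω => (X ω, Z ω)) + entropy p (fun ω => (Y ω, Z ω)) := by
  set P := probOf p (fun ω => (X ω, Y ω, Z ω)) with hP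
  set PX := probOf p (fun ω => (X ω, Z ω)) with hPX
  set PY := probOf p (fun ω => (Y ω, Z ω)) with hPY
  set PZ := probOf p Z with hPZ
  have hPn := probOf_nonneg hp (fun ω => (X ω, Y ω, Z ω))
  have hPXn := probOf_nonneg hp (fun ω => (X ω, Z ω))
  have hPYn := probOf_nonneg hp (fun ω => (Y ω, Z ω))
  have hPZn := probOf_nonneg hp Z
  let q : α × β × γ → ℝ := fun i => PX (i.1, i.2.2) * PY (i.2.1, i.2.2) / PZ i.2.2
  have hq : ∀ i, 0 ≤ q i := fun i => div_nonneg (mul_nonneg (hPXn _) (hPYn _)) (hPZn _)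
  have mX : ∀ x z, PX (x, z) = ∑ y, P (x, y, z) := by
    intro x z
    classical
    simp only [hPX, hP, probOf, Prod.mk.injEq]
    rw [Finset.sum_comm]
    refine Finset.sum_congr rfl fun ω _ => ?_
    by_cases h : X ω = x <;> by_cases h' : Z ω = z <;> simp [h, h']
  have mY : ∀ y z, PY (y, z) = ∑ x, P (x, y, z) := fun y z =>
    (sum_probOf_prod_left p X (fun ω => (Y ω, Z ω)) (y, z)).symm
  have mZX : ∀ z, PZ z = ∑ x, PX (x, z) := fun z => (sum_probOf_prod_left p X Z z).symm
  have mZY : ∀ z, PZ z = ∑ y, PY (y, z) := fun z => (sum_probOf_prod_left p Y Z z).symm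
  have lX : ∀ x y z, P (x, y, z) ≤ PX (x, z) := fun x y z => by
    rw [mX]; exact Finset.single_le_sum (fun y _ => hPn (x, y, z)) (Finset.mem_univ y)
  have lY : ∀ x y z, P (x, y, z) ≤ PY (y, z) := fun x y z => by
    rw [mY]; exact Finset.single_le_sum (fun x _ => hPn (x, y, z)) (Finset.mem_univ x)
  have lZ : ∀ x z, PX (x, z) ≤ PZ z := fun x z => by
    rw [mZX]; exact Finset.single_le_sum (fun x _ => hPXn (x, z)) (Finset.mem_univ x)
  have hqP : ∀ i, q i = 0 → P i = 0 := by
    rintro ⟨x, y, z⟩ h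
    have h1 := lX x y z
    have h2 := lY x y z
    have h3 := lZ x z
    have h4 : 0 ≤ P (x, y, z) := hPn _
    by_contra hne
    have h5 : 0 < P (x, y, z) := h4.lt_of_ne' hne
    have : 0 < q (x, y, z) :=
      div_pos (mul_pos (h5.trans_le h1) (h5.trans_le h2)) (h5.trans_le (h1.trans h3))
    exact this.ne' h
  have hsum : ∑ i, q i ≤ ∑ i, P i := by
    rw [hP, sum_probOf, ← sum_probOf p Z, ← hPZ, Fintype.sum_prod_type]
    simp only [Fintype.sum_prod_type]
    rw [Finset.sum_congr rfl fun x _ => Finset.sum_comm, Finset.sum_comm]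
    refine Finset.sum_le_sum fun z _ => ?_
    simp only [q]
    simp only [← Finset.sum_div, ← Finset.mul_sum, ← Finset.sum_mul, ← mZX, ← mZY]
    exact (mul_self_div_self _).le
  have key := gibbs_nonneg hPn hq hqP hsum
  rw [← hP, sum_probOf_mul p (fun ω => (X ω, Y ω, Z ω))
    (fun i => Real.log (P i) - Real.log (q i))] at key
  simp only [entropy_eq_sum, ← Finset.sum_add_distrib]
  rw [← sub_nonneg, ← Finset.sum_sub_distrib]
  refine key.trans_eq (Finset.sum_congr rfl fun ω _ => ?_)
  rcases (hp ω).eq_or_lt with h0 | h0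
  · simp [← h0]
  have h1 : 0 < P (X ω, Y ω, Z ω) :=
    h0.trans_le (le_probOf_self hp (fun ω => (X ω, Y ω, Z ω)) ω)
  have h2 := h1.trans_le (lX _ _ _)
  have h3 := h1.trans_le (lY _ _ _)
  have h4 := h2.trans_le (lZ _ _)
  simp only [q]
  rw [Real.log_div (mul_pos h2 h3).ne' h4.ne', Real.log_mul h2.ne' h3.ne']
  ring

/-- Mutual information is the relative entropy of the joint law with respect to the product law, so
Gibbs' inequality and its equality case yield nonnegativity and the criterion for independence. -/
theorem mutualInfo_eq_sum [Fintype α] [Fintype β] {p : Ω → ℝ} (hp : ∀ ω, 0 ≤ p ω)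
    (X : Ω → α) (Y : Ω → β) :
    mutualInfo p X Y = ∑ i : α × β, probOf p (fun ω => (X ω, Y ω)) i *
      (Real.log (probOf p (fun ω => (X ω, Y ω)) i) -
        Real.log (probOf p X i.1 * probOf p Y i.2)) := by
  rw [sum_probOf_mul p (fun ω => (X ω, Y ω)) (fun i =>
    Real.log (probOf p (fun ω => (X ω, Y ω)) i) - Real.log (probOf p X i.1 * probOf p Y i.2))]
  simp only [mutualInfo, entropy_eq_sum, ← Finset.sum_add_distrib, ← Finset.sum_sub_distrib]
  refine Finset.sum_congr rfl fun ω _ => ?_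
  rcases (hp ω).eq_or_lt with h0 | h0
  · simp [← h0]
  rw [Real.log_mul (h0.trans_le (le_probOf_self hp X ω)).ne'
    (h0.trans_le (le_probOf_self hp Y ω)).ne']
  ring

theorem probOf_prod_eq_zero [Fintype α] [Fintype β] {p : Ω → ℝ} (hp : ∀ ω, 0 ≤ p ω)
    (X : Ω → α) (Y : Ω → β) (i : α × β) (h : probOf p X i.1 * probOf p Y i.2 = 0) :
    probOf p (fun ω => (X ω, Y ω)) i = 0 := by
  have hn := probOf_nonneg hp (fun ω => (X ω, Y ω))
  rcases mul_eq_zero.1 h with h | h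
  · rw [← sum_probOf_prod_right p X Y, Finset.sum_eq_zero_iff_of_nonneg fun y _ => hn _] at h
    exact h i.2 (Finset.mem_univ _)
  · rw [← sum_probOf_prod_left p X Y, Finset.sum_eq_zero_iff_of_nonneg fun y _ => hn _] at h
    exact h i.1 (Finset.mem_univ _)

theorem sum_mul_probOf [Fintype α] [Fintype β] {p : Ω → ℝ} (hp1 : ∑ ω, p ω = 1)
    (X : Ω → α) (Y : Ω → β) :
    ∑ i : α × β, probOf p X i.1 * probOf p Y i.2 = ∑ i, probOf p (fun ω => (X ω, Y ω)) i := by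
  rw [sum_probOf, hp1, Fintype.sum_prod_type]
  simp [← Finset.mul_sum, sum_probOf, hp1]

theorem mutualInfo_nonneg [Fintype α] [Fintype β] {p : Ω → ℝ} (hp : ∀ ω, 0 ≤ p ω)
    (hp1 : ∑ ω, p ω = 1) (X : Ω → α) (Y : Ω → β) : 0 ≤ mutualInfo p X Y := by
  rw [mutualInfo_eq_sum hp]
  exact gibbs_nonneg (probOf_nonneg hp _)
    (fun i => mul_nonneg (probOf_nonneg hp _ _) (probOf_nonneg hp _ _))
    (probOf_prod_eq_zero hp X Y) (sum_mul_probOf hp1 X Y).le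

theorem mutualInfo_eq_zero_iff [Fintype α] [Fintype β] {p : Ω → ℝ} (hp : ∀ ω, 0 ≤ p ω)
    (hp1 : ∑ ω, p ω = 1) (X : Ω → α) (Y : Ω → β) :
    mutualInfo p X Y = 0 ↔
      ∀ x y, probOf p (fun ω => (X ω, Y ω)) (x, y) = probOf p X x * probOf p Y y := by
  rw [mutualInfo_eq_sum hp]
  refine ⟨fun h x y => ?_, fun h => Finset.sum_eq_zero fun i _ => ?_⟩
  · exact eq_of_gibbs_eq_zero (probOf_nonneg hp _)
      (fun i => mul_nonneg (probOf_nonneg hp _ _) (probOf_nonneg hp _ _))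
      (probOf_prod_eq_zero hp X Y) (sum_mul_probOf hp1 X Y).le h (x, y)
  · rw [← h i.1 i.2]
    simp

theorem entropy_pair_eq_of_determines [Fintype α] [Fintype β] {p : Ω → ℝ} (hp : ∀ ω, 0 ≤ p ω)
    {X : Ω → α} {Y : Ω → β} (h : ∀ ω ω', Y ω = Y ω' → X ω = X ω') :
    entropy p (fun ω => (X ω, Y ω)) = entropy p Y :=
  entropy_eq_of_kernel hp fun ω ω' => by
    simp only [Prod.mk.injEq]
    exact ⟨fun e => ⟨h _ _ e, e⟩, And.right⟩

/-- If `H(X | Y) = 0`, then `Y` determines `X` on the outcomes of positive probability. -/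
theorem eq_of_condEntropy_eq_zero [Fintype α] [Fintype β] {p : Ω → ℝ} (hp : ∀ ω, 0 ≤ p ω)
    {X : Ω → α} {Y : Ω → β} (h : condEntropy p X Y = 0) {ω ω' : Ω} (hω : 0 < p ω)
    (hω' : 0 < p ω') (hY : Y ω = Y ω') : X ω = X ω' := by
  classical
  -- The two entropies agree and compare term by term, so each term of positive weight agrees: the
  -- fibres of Y and of (X, Y) through such an outcome have the same mass.
  have hle : ∀ ω ∈ Finset.univ, p ω * -Real.log (probOf p Y (Y ω)) ≤
      p ω * -Real.log (probOf p (fun ω => (X ω, Y ω)) (X ω, Y ω)) := by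
    intro ω _
    rcases (hp ω).eq_or_lt with h0 | h0
    · simp [← h0]
    refine mul_le_mul_of_nonneg_left (neg_le_neg (Real.log_le_log ?_ ?_)) h0.le
    · exact h0.trans_le (le_probOf_self hp (fun ω => (X ω, Y ω)) ω)
    · exact probOf_le_of_determines hp (X := Y) (Y := fun ω => (X ω, Y ω))
        (fun _ _ e => (Prod.mk.inj e).2) ω
  have heq := (Finset.sum_eq_sum_iff_of_le hle).1 (by
    rw [← entropy_eq_sum, ← entropy_eq_sum p (fun ω => (X ω, Y ω))]
    unfold condEntropy at h
    linarith) ω (Finset.mem_univ ω)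
  have h1 := mul_left_cancel₀ hω.ne' heq
  have h2 := Real.log_injOn_pos (Set.mem_Ioi.2 (hω.trans_le (le_probOf_self hp Y ω)))
    (Set.mem_Ioi.2 (hω.trans_le (le_probOf_self hp (fun ω => (X ω, Y ω)) ω))) (neg_injective h1)
  by_contra hne
  simp only [probOf] at h2
  have h3 := (Finset.sum_eq_sum_iff_of_le (s := Finset.univ)
    (f := fun ω'' => if (X ω'', Y ω'') = (X ω, Y ω) then p ω'' else 0)
    (g := fun ω'' => if Y ω'' = Y ω then p ω'' else 0) (fun ω'' _ => by
      by_cases hy : Y ω'' = Y ω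
      · by_cases hx : X ω'' = X ω <;> simp [hx, hy, hp]
      · simp [hy])).1 (by convert h2.symm) ω' (Finset.mem_univ _)
  simp [hY.symm, Ne.symm hne, hω'.ne] at h3

end Entropy

/-! ### Extension of independent families and Rado's theorem. -/

section LinearAlgebra

variable {K V : Type*} [Field K] [AddCommGroup V] [Module K V]

theorem sumExtend_inl {ι : Type*} {v : ι → V} (hv : LinearIndependent K v) (i : ι) :
    Module.Basis.sumExtend hv (Sum.inl i) = v i := by
  simp [Module.Basis.sumExtend]
  rfl

/-- Both families extend to bases, and the two sets of added vectors have the same size. Privacy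
rests on this: equally indexed independent families are indistinguishable after a uniformly random
change of basis. -/
theorem exists_linearEquiv_of_linearIndependent [FiniteDimensional K V] {ι : Type*} {v w : ι → V}
    (hv : LinearIndependent K v) (hw : LinearIndependent K w) :
    ∃ g : V ≃ₗ[K] V, ∀ i, g (v i) = w i := by
  have hfv := Module.Finite.finite_basis (Module.Basis.sumExtend hv)
  have hfw := Module.Finite.finite_basis (Module.Basis.sumExtend hw)
  have : Finite ι :=
    Finite.of_injective (Sum.inl : ι → ι ⊕ Module.Basis.sumExtendIndex hv) Sum.inl_injective
  have : Finite (Module.Basis.sumExtendIndex hv) :=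
    Finite.of_injective (Sum.inr : _ → ι ⊕ _) Sum.inr_injective
  have : Finite (Module.Basis.sumExtendIndex hw) :=
    Finite.of_injective (Sum.inr : _ → ι ⊕ _) Sum.inr_injective
  have h1 := Module.finrank_eq_nat_card_basis (Module.Basis.sumExtend hv)
  have h2 := Module.finrank_eq_nat_card_basis (Module.Basis.sumExtend hw)
  rw [Nat.card_sum] at h1 h2
  obtain ⟨e⟩ : Nonempty (Module.Basis.sumExtendIndex hv ≃ Module.Basis.sumExtendIndex hw) :=
    Finite.card_eq.1 (by omega)
  refine ⟨(Module.Basis.sumExtend hv).equiv (Module.Basis.sumExtend hw)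
    (Equiv.sumCongr (Equiv.refl ι) e), fun i => ?_⟩
  have := (Module.Basis.sumExtend hv).equiv_apply (Sum.inl i) (Module.Basis.sumExtend hw)
    (Equiv.sumCongr (Equiv.refl ι) e)
  rw [sumExtend_inl] at this
  rw [this]
  simp [sumExtend_inl]

theorem exists_linearIndependent_extension [FiniteDimensional K V] {a g : ℕ}
    (hag : a + g = Module.finrank K V)
    {f : Fin a → V} (hf : LinearIndependent K f) :
    ∃ b : Fin a ⊕ Fin g → V, LinearIndependent K b ∧ ∀ i, b (Sum.inl i) = f i := by
  have hfv := Module.Finite.finite_basis (Module.Basis.sumExtend hf)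
  have : Finite (Module.Basis.sumExtendIndex hf) :=
    Finite.of_injective (Sum.inr : _ → Fin a ⊕ _) Sum.inr_injective
  have h1 := Module.finrank_eq_nat_card_basis (Module.Basis.sumExtend hf)
  rw [Nat.card_sum, Nat.card_eq_fintype_card, Fintype.card_fin] at h1
  obtain ⟨e⟩ : Nonempty (Fin g ≃ Module.Basis.sumExtendIndex hf) :=
    Finite.card_eq.1 (by rw [Nat.card_eq_fintype_card, Fintype.card_fin]; omega)
  refine ⟨Module.Basis.sumExtend hf ∘ Sum.map id e, ?_, fun i => ?_⟩
  · exact (Module.Basis.sumExtend hf).linearIndependent.comp _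
      (Function.injective_id.sumMap e.injective)
  · simp [sumExtend_inl]

/-- Rado's theorem for vectors: a finite family of finite sets of vectors, the union of any `k` of
which has rank at least `k`, has a linearly independent transversal. -/
theorem exists_linearIndependent_transversal [FiniteDimensional K V] {ι : Type*} [Fintype ι]
    [DecidableEq ι] [DecidableEq V] (A : ι → Finset V)
    (hA : ∀ J : Finset ι, #J ≤ Module.finrank K (Submodule.span K (J.biUnion A : Set V))) :
    ∃ v : ι → V, (∀ i, v i ∈ A i) ∧ LinearIndependent K v := by
  -- Sets are shrunk one vector at a time until all are singletons, keeping the rank condition.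
  induction hs : ∑ i, #(A i) using Nat.strong_induction_on generalizing A with
  | _ s ih =>
  by_cases hbig : ∃ i, 1 < #(A i)
  · obtain ⟨i, hi⟩ := hbig
    obtain ⟨x, hx, y, hy, hxy⟩ := Finset.one_lt_card.1 hi
    have reduce : ∀ z ∈ A i, (∀ J : Finset ι, #J ≤ Module.finrank K
        (Submodule.span K (J.biUnion (Function.update A i ((A i).erase z)) : Set V))) →
        ∃ v : ι → V, (∀ i, v i ∈ A i) ∧ LinearIndependent K v := by
      intro z hz h
      have hsub : ∀ k, Function.update A i ((A i).erase z) k ⊆ A k := by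
        intro k
        by_cases hk : k = i
        · subst hk; simpa using Finset.erase_subset z (A k)
        · simp [hk]
      obtain ⟨v, hv, hv'⟩ := ih _ (by
        rw [← hs]
        refine Finset.sum_lt_sum (fun k _ => Finset.card_le_card (hsub k)) ⟨i, mem_univ i, ?_⟩
        simpa using Finset.card_erase_lt_of_mem hz) _ h rfl
      exact ⟨v, fun k => hsub k (hv k), hv'⟩
    have bad : ∀ z, ∀ J : Finset ι, ¬ #J ≤ Module.finrank K
        (Submodule.span K (J.biUnion (Function.update A i ((A i).erase z)) : Set V)) → i ∈ J := by
      intro z J hJ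
      by_contra hiJ
      apply hJ
      have : J.biUnion (Function.update A i ((A i).erase z)) = J.biUnion A :=
        Finset.biUnion_congr rfl fun k hk => by
          rw [Function.update_of_ne (by rintro rfl; exact hiJ hk)]
      rw [this]
      exact hA J
    by_contra hno
    have hx' := mt (reduce x hx) hno
    have hy' := mt (reduce y hy) hno
    push Not at hx' hy'
    obtain ⟨J₁, h₁⟩ := hx'
    obtain ⟨J₂, h₂⟩ := hy'
    have i₁ := bad x J₁ h₁.not_ge
    have i₂ := bad y J₂ h₂.not_ge
    set S₁ := Submodule.span K (J₁.biUnion (Function.update A i ((A i).erase x)) : Set V)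
    set S₂ := Submodule.span K (J₂.biUnion (Function.update A i ((A i).erase y)) : Set V)
    have hdim := Submodule.finrank_sup_add_finrank_inf_eq S₁ S₂
    have hmem₁ : ∀ k ∈ J₁, ∀ u ∈ A k, (k = i → u ≠ x) → u ∈ S₁ := by
      intro k hk u hu hux
      refine Submodule.subset_span (Finset.mem_coe.2 (Finset.mem_biUnion.2 ⟨k, hk, ?_⟩))
      by_cases hki : k = i
      · subst hki; simpa using ⟨hux rfl, hu⟩
      · simpa [hki] using hu
    have hmem₂ : ∀ k ∈ J₂, ∀ u ∈ A k, (k = i → u ≠ y) → u ∈ S₂ := by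
      intro k hk u hu huy
      refine Submodule.subset_span (Finset.mem_coe.2 (Finset.mem_biUnion.2 ⟨k, hk, ?_⟩))
      by_cases hki : k = i
      · subst hki; simpa using ⟨huy rfl, hu⟩
      · simpa [hki] using hu
    -- If neither x nor y can be deleted, S₁ and S₂ have ranks below #J₁ and #J₂. But S₁ ⊔ S₂
    -- recovers the full union over J₁ ∪ J₂, because x ≠ y, and S₁ ⊓ S₂ still contains the sets over
    -- J₁ ∩ J₂ other than the i-th. The rank condition on these two gives a total of at least #J₁ +
    -- #J₂ - 1, a contradiction.
    have hsup : Submodule.span K ((J₁ ∪ J₂).biUnion A : Set V) ≤ S₁ ⊔ S₂ := by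
      refine Submodule.span_le.2 fun u hu => ?_
      obtain ⟨k, hk, hu⟩ := Finset.mem_biUnion.1 (Finset.mem_coe.1 hu)
      by_cases hki : k = i
      · subst hki
        by_cases hux : u = x
        · exact Submodule.mem_sup_right (hmem₂ k i₂ u hu fun _ => hux ▸ hxy)
        · exact Submodule.mem_sup_left (hmem₁ k i₁ u hu fun _ => hux)
      · rcases Finset.mem_union.1 hk with hk | hk
        · exact Submodule.mem_sup_left (hmem₁ k hk u hu fun h => absurd h hki)
        · exact Submodule.mem_sup_right (hmem₂ k hk u hu fun h => absurd h hki)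
    have hinf : Submodule.span K (((J₁ ∩ J₂).erase i).biUnion A : Set V) ≤ S₁ ⊓ S₂ := by
      refine Submodule.span_le.2 fun u hu => ?_
      obtain ⟨k, hk, hu⟩ := Finset.mem_biUnion.1 (Finset.mem_coe.1 hu)
      obtain ⟨hki, hk⟩ := Finset.mem_erase.1 hk
      obtain ⟨hk1, hk2⟩ := Finset.mem_inter.1 hk
      exact ⟨hmem₁ k hk1 u hu fun h => absurd h hki, hmem₂ k hk2 u hu fun h => absurd h hki⟩
    have d1 := (hA _).trans (Submodule.finrank_mono hsup)
    have d2 := (hA _).trans (Submodule.finrank_mono hinf)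
    have d3 := Finset.card_erase_add_one (Finset.mem_inter.2 ⟨i₁, i₂⟩)
    have d4 := Finset.card_union_add_card_inter J₁ J₂
    omega
  · push Not at hbig
    have hne : ∀ i, (A i).Nonempty := by
      intro i
      have := hA {i}
      rw [Finset.singleton_biUnion] at this
      by_contra h
      rw [Finset.not_nonempty_iff_eq_empty] at h
      simp [h] at this
    choose v hv using hne
    refine ⟨v, hv, ?_⟩
    rw [linearIndependent_iff_card_le_finrank_span]
    have := hA univ
    rw [Finset.card_univ] at this
    refine this.trans (Submodule.finrank_mono (Submodule.span_mono fun u hu => ?_))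
    obtain ⟨k, -, hu⟩ := Finset.mem_biUnion.1 (Finset.mem_coe.1 hu)
    exact ⟨k, Finset.card_le_one.1 (hbig k) _ (hv k) _ hu⟩

end LinearAlgebra

/-! ### Array codes from Reed-Solomon codes over an extension field. -/

section Code

variable {F K : Type*} [Field F] [Field K] [Algebra F K]

/-- Enlarge the set to exactly T points and use the invertible square Vandermonde matrix. -/
theorem linearIndependent_vandermonde_of_card_le {K : Type*} [Field K] {N T : ℕ} (hTN : T ≤ N)
    {y : Fin N → K}
    (hy : Function.Injective y) {Γ : Finset (Fin N)} (hΓ : #Γ ≤ T) :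
    LinearIndependent K (fun (j : Γ) (i : Fin T) => y j ^ (i : ℕ)) := by
  obtain ⟨Γ', hsub, -, hcard⟩ := Finset.exists_subsuperset_card_eq (Finset.subset_univ Γ) hΓ
    (by simpa using hTN)
  let σ : Fin T ≃ Γ' := (Γ'.equivFinOfCardEq hcard).symm
  have hdet : IsUnit (Matrix.vandermonde fun i : Fin T => y (σ i)) := by
    rw [Matrix.isUnit_iff_isUnit_det, isUnit_iff_ne_zero, Matrix.det_vandermonde_ne_zero_iff]
    exact hy.comp (Subtype.val_injective.comp σ.injective)
  have h1 := Matrix.linearIndependent_rows_iff_isUnit.2 hdet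
  have h2 := h1.comp (fun j : Γ => σ.symm ⟨j, hsub j.2⟩) fun a b h =>
    Subtype.ext (congrArg (fun z : Γ' => (z : Fin N)) (σ.symm.injective h))
  have h3 : (fun (j : Γ) (i : Fin T) => y j ^ (i : ℕ)) =
      (Matrix.vandermonde fun i : Fin T => y (σ i)).row ∘ fun j : Γ => σ.symm ⟨j, hsub j.2⟩ := by
    ext j i
    change _ = y (σ (σ.symm ⟨j, hsub j.2⟩)) ^ (i : ℕ)
    rw [Equiv.apply_symm_apply]
  rw [h3]
  exact h2

theorem linearIndependent_sigma_smul {ι : Type*} [Fintype ι] {κ : ι → Type*} [∀ i, Fintype (κ i)]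
    {U : Type*} [AddCommGroup U] [Module K U] [Module F U] [IsScalarTower F K U]
    {c : ι → U} (hc : LinearIndependent K c)
    {b : ∀ i, κ i → K} (hb : ∀ i, LinearIndependent F (b i)) :
    LinearIndependent F (fun p : Σ i, κ i => b p.1 p.2 • c p.1) := by
  rw [Fintype.linearIndependent_iff]
  intro g hg
  rw [Fintype.sum_sigma] at hg
  have h1 : ∀ i, ∑ k, g ⟨i, k⟩ • b i k = 0 := by
    refine Fintype.linearIndependent_iff.1 hc _ ?_
    rw [← hg]
    refine Finset.sum_congr rfl fun i _ => ?_
    rw [Finset.sum_smul]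
    exact Finset.sum_congr rfl fun k _ => smul_assoc _ _ _
  rintro ⟨i, k⟩
  exact Fintype.linearIndependent_iff.1 (hb i) _ (h1 i) k

/-- A family of lines over `K`, viewed over a subfield `F`, has bases in which prescribed partial
bases of the lines span the whole space. -/
theorem exists_adapted_line_bases [FiniteDimensional F K] [Fintype K] {U : Type*} [AddCommGroup U]
    [Module K U] [Module F U] [IsScalarTower F K U] [FiniteDimensional F U] {N T : ℕ}
    {c : Fin N → U} (hc : ∀ Γ : Finset (Fin N), #Γ ≤ T → LinearIndependent K (fun j : Γ => c j))
    {α γ : Fin N → ℕ} (hαγ : ∀ j, α j + γ j = Module.finrank F K)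
    (hα : ∑ j, α j = T * Module.finrank F K) (hU : Module.finrank F U = T * Module.finrank F K) :
    ∃ e : ∀ j, Fin (α j) ⊕ Fin (γ j) → U,
      (∀ Γ : Finset (Fin N), #Γ ≤ T →
        LinearIndependent F (fun p : Σ j : Γ, (Fin (α j) ⊕ Fin (γ j)) => e p.1 p.2)) ∧
      Submodule.span F (Set.range fun p : Σ j, Fin (α j) => e p.1 (Sum.inl p.2)) = ⊤ := by
  classical
  -- Rado's theorem is applied to α j copies of the j-th line, so a transversal picks α j
  -- independent vectors of each line.
  let A : (Σ j, Fin (α j)) → Finset U := fun p => univ.image fun x : K => x • c p.1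
  have hA : ∀ J : Finset (Σ j, Fin (α j)),
      #J ≤ Module.finrank F (Submodule.span F (J.biUnion A : Set U)) := by
    intro J
    let J' := J.image Sigma.fst
    obtain ⟨Γ, hΓJ, hΓ⟩ := Finset.exists_subset_card_eq (min_le_left #J' T)
    have hind := linearIndependent_sigma_smul (F := F) (hc Γ (by omega))
      (κ := fun _ => Fin (Module.finrank F K)) (b := fun _ => Module.finBasis F K)
      (fun _ => (Module.finBasis F K).linearIndependent)
    have h1 := finrank_span_eq_card hind
    have h2 : Fintype.card (Σ _ : Γ, Fin (Module.finrank F K)) = #Γ * Module.finrank F K := by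
      simp
    rw [h2] at h1
    have h3 : #Γ * Module.finrank F K ≤
        Module.finrank F (Submodule.span F (J.biUnion A : Set U)) := by
      rw [← h1]
      refine Submodule.finrank_mono (Submodule.span_mono ?_)
      rintro _ ⟨⟨j, x⟩, rfl⟩
      obtain ⟨p, hp, hpj⟩ := Finset.mem_image.1 (hΓJ j.2)
      refine Finset.mem_coe.2 (Finset.mem_biUnion.2 ⟨p, hp, ?_⟩)
      exact Finset.mem_image.2 ⟨_, mem_univ _, by rw [hpj]⟩
    refine le_trans ?_ h3
    have h4 : #J ≤ ∑ j ∈ J', α j := by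
      calc #J ≤ #(J'.sigma fun _ => univ) := Finset.card_le_card fun p hp =>
            Finset.mem_sigma.2 ⟨Finset.mem_image_of_mem _ hp, mem_univ _⟩
        _ = _ := by simp
    refine h4.trans ?_
    rw [hΓ]
    -- Few lines: they are independent and each holds at most its full dimension of chosen vectors.
    -- More than T lines: T of them already fill a space whose dimension is the total number of
    -- vectors.
    rcases le_total #J' T with h | h
    · rw [min_eq_left h, ← smul_eq_mul]
      exact Finset.sum_le_card_nsmul _ _ _ fun j _ => by have := hαγ j; omega
    · rw [min_eq_right h, ← hα]
      exact Finset.sum_le_sum_of_subset (subset_univ _)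
  obtain ⟨v, hvA, hv⟩ := exists_linearIndependent_transversal (K := F) A hA
  have hk : ∀ p, ∃ x : K, x • c p.1 = v p := fun p => by
    obtain ⟨x, -, hx⟩ := Finset.mem_image.1 (hvA p)
    exact ⟨x, hx⟩
  choose k hk using hk
  have hkind : ∀ j, LinearIndependent F (fun i : Fin (α j) => k ⟨j, i⟩) := by
    intro j
    refine LinearIndependent.of_comp
      ((LinearMap.toSpanSingleton K U (c j)).restrictScalars F) ?_
    have : (LinearMap.toSpanSingleton K U (c j)).restrictScalars F ∘
        (fun i : Fin (α j) => k ⟨j, i⟩) = v ∘ Sigma.mk j := funext fun i => hk ⟨j, i⟩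
    rw [this]
    exact hv.comp (Sigma.mk j) sigma_mk_injective
  choose b hb hbk using fun j => exists_linearIndependent_extension (hαγ j) (hkind j)
  refine ⟨fun j x => b j x • c j, fun Γ hΓ => ?_, ?_⟩
  · exact linearIndependent_sigma_smul (F := F) (c := fun j : Γ => c j) (hc Γ hΓ)
      (κ := fun j : Γ => Fin (α j) ⊕ Fin (γ j)) (b := fun j => b j) fun j => hb j
  · have : (fun p : Σ j, Fin (α j) => b p.1 (Sum.inl p.2) • c p.1) = v := by
      ext1 ⟨j, i⟩
      rw [← hk, hbk]
    have hcard : Fintype.card (Σ j, Fin (α j)) = Module.finrank F U := by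
      rw [Fintype.card_sigma, hU]
      simpa using hα
    rw [this]
    exact hv.span_eq_top_of_card_eq_finrank' hcard

/-- Over any subfield `F` of `K`, the `K`-linear Reed-Solomon code of dimension `T` has, after a
change of bases of its blocks, the prescribed partial blocks as an information set. -/
theorem exists_array_code [FiniteDimensional F K] [Fintype K] {N T : ℕ} (hTN : T ≤ N)
    {y : Fin N → K} (hy : Function.Injective y) {α γ : Fin N → ℕ}
    (hαγ : ∀ j, α j + γ j = Module.finrank F K) (hα : ∑ j, α j = T * Module.finrank F K) :
    ∃ e : ∀ j, Fin (α j) ⊕ Fin (γ j) → (Fin T → K),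
      (∀ Γ : Finset (Fin N), #Γ ≤ T →
        LinearIndependent F (fun p : Σ j : Γ, (Fin (α j) ⊕ Fin (γ j)) => e p.1 p.2)) ∧
      Submodule.span F (Set.range fun p : Σ j, Fin (α j) => e p.1 (Sum.inl p.2)) = ⊤ :=
  exists_adapted_line_bases (c := fun j (i : Fin T) => y j ^ (i : ℕ))
    (fun _ hΓ => linearIndependent_vandermonde_of_card_le hTN hy hΓ) hαγ hα
    (by rw [Module.finrank_pi_fintype]; simp)

/-- The field with 2 ^ β elements supplies the N distinct evaluation points; each of its symbols is
a block of β bits. -/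
theorem exists_binary_array_code {N T β : ℕ} (hTN : T ≤ N) (hβ : β ≠ 0) (hN : N ≤ 2 ^ β)
    {α γ : Fin N → ℕ} (hαγ : ∀ j, α j + γ j = β) (hα : ∑ j, α j = T * β) :
    ∃ e : ∀ j, Fin (α j) ⊕ Fin (γ j) → (Fin (T * β) → ZMod 2),
      (∀ Γ : Finset (Fin N), #Γ ≤ T →
        LinearIndependent (ZMod 2)
          (fun p : Σ j : Γ, (Fin (α j) ⊕ Fin (γ j)) => e p.1 p.2)) ∧
      Submodule.span (ZMod 2) (Set.range fun p : Σ j, Fin (α j) => e p.1 (Sum.inl p.2)) = ⊤ := by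
  have : Fintype (GaloisField 2 β) := Fintype.ofFinite _
  have hrank := GaloisField.finrank 2 hβ
  obtain ⟨y⟩ : Nonempty (Fin N ↪ GaloisField 2 β) := by
    refine Function.Embedding.nonempty_of_card_le ?_
    rw [Fintype.card_fin, ← Nat.card_eq_fintype_card, GaloisField.card 2 β hβ]
    exact hN
  obtain ⟨e, he, hspan⟩ := exists_array_code (F := ZMod 2) hTN y.injective
    (fun j => (hαγ j).trans hrank.symm) (by rw [hrank]; exact hα)
  let φ : (Fin T → GaloisField 2 β) ≃ₗ[ZMod 2] (Fin (T * β) → ZMod 2) :=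
    LinearEquiv.ofFinrankEq _ _ (by rw [Module.finrank_pi_fintype]; simp [hrank])
  refine ⟨fun j x => φ (e j x), fun Γ hΓ => ?_, ?_⟩
  · exact (he Γ hΓ).map' φ.toLinearMap φ.ker
  · have := congrArg (Submodule.map φ.toLinearMap) hspan
    rw [Submodule.map_span, Submodule.map_top, LinearEquiv.range, ← Set.range_comp] at this
    exact this

end Code

/-! ### Integral loads of the servers and the counts they produce. -/

section Loads

/-- The number of symbols of a server that are shared by the servers per set of `k` records, when
one record of the other ones is retrieved. -/
def blockSize (n t M k : ℕ) : ℕ := (n - t) ^ (k - 1) * t ^ (M - 1 - k)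

/-- `n` times the average number of sums that a server returns per set of `k` records. -/
def averageLoad (n t M k : ℕ) : ℕ := (n - t) ^ (k - 1) * t ^ (M - k)

/-- The number of sums that a server returns per set of `k` records, if it returns `a` of them per
single record. -/
def serverLoad (n t M a : ℕ) : ℕ → ℕ
  | 0 => 0
  | 1 => a
  | k + 2 => blockSize n t M (k + 1) - serverLoad n t M a (k + 1)

variable {n t M : ℕ}

/-- The averages satisfy the same relation as the individual loads, so the rounding error of a
server only changes sign from k to k + 1. -/
theorem averageLoad_add (htn : t ≤ n) {k : ℕ} (hk : 1 ≤ k) (hkM : k < M) :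
    averageLoad n t M k + averageLoad n t M (k + 1) = n * blockSize n t M k := by
  obtain ⟨k, rfl⟩ := Nat.exists_eq_add_of_le' hk
  obtain ⟨c, rfl⟩ := Nat.exists_eq_add_of_lt hkM
  obtain ⟨s, rfl⟩ := Nat.exists_eq_add_of_le htn
  simp only [averageLoad, blockSize, Nat.add_sub_cancel, Nat.add_sub_cancel_left,
    show k + 1 + c + 1 - (k + 1) = c + 1 by omega,
    show k + 1 + c + 1 - (k + 1 + 1) = c by omega]
  ring

/-- The deviation of n times the load from `averageLoad` alternates in sign with constant modulus
less than n. As the next average is positive, the load cannot exceed the block size, so the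
truncated subtraction in `serverLoad` is genuine. -/
theorem serverLoad_bounds (ht : 0 < t) (htn : t < n) {a : ℕ}
    (ha : n * a < averageLoad n t M 1 + n) (ha' : averageLoad n t M 1 < n * a + n)
    {k : ℕ} (hk : 1 ≤ k) (hkM : k ≤ M) :
    n * serverLoad n t M a k < averageLoad n t M k + n ∧
      averageLoad n t M k < n * serverLoad n t M a k + n ∧
      (k < M → serverLoad n t M a k ≤ blockSize n t M k) := by
  have hle : ∀ k, 1 ≤ k → k < M → n * serverLoad n t M a k < averageLoad n t M k + n →
      serverLoad n t M a k ≤ blockSize n t M k := by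
    intro k hk hkM h
    have h1 := averageLoad_add (M := M) htn.le hk hkM
    have h2 : 0 < averageLoad n t M (k + 1) :=
      Nat.mul_pos (pow_pos (by omega) _) (pow_pos ht _)
    have h3 : n * serverLoad n t M a k < n * (blockSize n t M k + 1) := by
      rw [mul_add, ← h1]; omega
    exact Nat.lt_succ_iff.1 (lt_of_mul_lt_mul_left h3 (Nat.zero_le n))
  induction k, hk using Nat.le_induction with
  | base => exact ⟨ha, ha', fun h => hle 1 le_rfl h ha⟩
  | succ k hk ih =>
    obtain ⟨h1, h2, h3⟩ := ih (by omega)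
    have h4 := averageLoad_add (M := M) htn.le hk (by omega)
    have h5 : serverLoad n t M a k + serverLoad n t M a (k + 1) = blockSize n t M k := by
      obtain ⟨k, rfl⟩ := Nat.exists_eq_add_of_le' hk
      rw [serverLoad, Nat.add_sub_cancel' (h3 (by omega))]
    have h6 : n * serverLoad n t M a k + n * serverLoad n t M a (k + 1) =
        n * blockSize n t M k := by rw [← mul_add, h5]
    have h7 : n * serverLoad n t M a (k + 1) < averageLoad n t M (k + 1) + n := by omega
    exact ⟨h7, by omega, fun h => hle _ (by omega) h h7⟩

theorem exists_serverLoads (ht : 0 < t) (htn : t < n) (d : ℕ) :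
    ∃ α : Fin (d * n) → ℕ → ℕ, (∀ j, α j 0 = 0) ∧
      (∀ j k, 1 ≤ k → k < M → α j k + α j (k + 1) = blockSize n t M k) ∧
      ∀ k, 1 ≤ k → k ≤ M → ∑ j, α j k = d * averageLoad n t M k := by
  set x := averageLoad n t M 1 with hx
  -- The average x / n is rounded up for d * (x % n) of the d * n servers and down for the others,
  -- so that the total is exactly d * x.
  let a : ℕ → ℕ := fun j => x / n + if j < d * (x % n) then 1 else 0
  have hx' := Nat.div_add_mod x n
  have hmod := Nat.mod_lt x (show n > 0 by omega)
  have ha : ∀ j, n * a j < x + n ∧ x < n * a j + n := by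
    intro j
    simp only [a, mul_add]
    split_ifs with h
    · have : 0 < x % n := Nat.pos_of_ne_zero fun h0 => by simp [h0] at h
      omega
    · omega
  have hb := fun (j : ℕ) (k : ℕ) (hk : 1 ≤ k) (hkM : k ≤ M) =>
    serverLoad_bounds ht htn (ha j).1 (ha j).2 hk hkM
  have hadd : ∀ (j : ℕ) k, 1 ≤ k → k < M →
      serverLoad n t M (a j) k + serverLoad n t M (a j) (k + 1) = blockSize n t M k := by
    intro j k hk hkM
    have := (hb j k hk hkM.le).2.2 hkM
    obtain ⟨k, rfl⟩ := Nat.exists_eq_add_of_le' hk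
    rw [serverLoad, Nat.add_sub_cancel' this]
  refine ⟨fun j => serverLoad n t M (a j), fun j => rfl, fun j => hadd j, fun k hk => ?_⟩
  induction k, hk using Nat.le_induction with
  | base =>
    intro _
    simp only [serverLoad, a, Finset.sum_add_distrib]
    rw [Fin.sum_univ_eq_sum_range (fun j => if j < d * (x % n) then 1 else 0) (d * n),
      Finset.sum_boole]
    have : (range (d * n)).filter (· < d * (x % n)) = range (d * (x % n)) := by
      ext j
      have := Nat.mul_le_mul_left d hmod.le
      simp only [mem_filter, mem_range]
      omega
    rw [this, ← hx]
    simp only [sum_const, card_univ, Fintype.card_fin, smul_eq_mul, card_range, Nat.cast_id]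
    rw [mul_assoc, ← mul_add, hx']
  | succ k hk ih =>
    intro hkM
    have h1 := ih (by omega)
    beta_reduce at h1 ⊢
    have h2 : ∑ j : Fin (d * n), (serverLoad n t M (a j) k + serverLoad n t M (a j) (k + 1)) =
        d * averageLoad n t M k + d * averageLoad n t M (k + 1) := by
      rw [Finset.sum_congr rfl fun (j : Fin (d * n)) _ => hadd j k hk (by omega), ← mul_add,
        averageLoad_add htn.le hk (by omega)]
      simp [mul_assoc]
    rw [Finset.sum_add_distrib, h1] at h2
    omega

/-- Both bases are at least μ and the exponents add up to M - 2. This is where μ enters the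
condition on M. -/
theorem pow_le_blockSize {μ : ℕ} (hμt : μ ≤ t) (hμn : μ ≤ n - t) {k : ℕ} (hk : 1 ≤ k)
    (hkM : k < M) : μ ^ (M - 2) ≤ blockSize n t M k := by
  rw [show M - 2 = (k - 1) + (M - 1 - k) by omega, pow_add]
  exact Nat.mul_le_mul (Nat.pow_le_pow_left hμn _) (Nat.pow_le_pow_left hμt _)

/-- The sums over the sets of records that contain `m` but not `θ`. -/
theorem sum_blockSize {θ m : Fin M} (hm : m ≠ θ) (htn : t ≤ n) :
    ∑ Λ : {Λ : Finset (Fin M) // θ ∉ Λ ∧ m ∈ Λ}, blockSize n t M #Λ.1 = n ^ (M - 2) := by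
  classical
  have hcard : #((univ.erase θ).erase m) = M - 2 := by
    rw [card_erase_of_mem (by simp [hm]), card_erase_of_mem (mem_univ _), card_univ,
      Fintype.card_fin]
    omega
  have h := Finset.sum_pow_mul_eq_add_pow (n - t) t ((univ.erase θ).erase m)
  rw [hcard, Nat.sub_add_cancel htn] at h
  rw [← h]
  refine (Finset.sum_bij' (fun s hs => (⟨insert m s, ?_⟩ : {Λ : Finset (Fin M) // θ ∉ Λ ∧ m ∈ Λ}))
    (fun Λ _ => Λ.1.erase m) ?_ ?_ ?_ ?_ ?_).symm
  · have hs' := Finset.mem_powerset.1 hs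
    refine ⟨fun hθ => ?_, mem_insert_self _ _⟩
    rcases mem_insert.1 hθ with h | h
    · exact hm h.symm
    · simpa using hs' h
  · intro s _; exact mem_univ _
  · intro Λ _
    refine mem_powerset.2 fun i hi => ?_
    obtain ⟨h1, h2⟩ := mem_erase.1 hi
    exact mem_erase.2 ⟨h1, mem_erase.2 ⟨fun h => Λ.2.1 (h ▸ h2), mem_univ _⟩⟩
  · intro s hs
    exact erase_insert fun h => by simpa using mem_powerset.1 hs h
  · intro Λ _
    exact Subtype.ext (insert_erase Λ.2.2)
  · intro s hs
    rw [card_insert_of_notMem fun h => by simpa using mem_powerset.1 hs h]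
    simp only [blockSize, Nat.add_sub_cancel]
    congr 2
    omega

/-- The binomial theorem over the subsets of the other records. Times d, this is the number of sums
that involve the desired record, and it equals L. -/
theorem sum_averageLoad_of_mem (θ : Fin M) (htn : t ≤ n) :
    ∑ Λ : Finset (Fin M), (if θ ∈ Λ then averageLoad n t M #Λ else 0) = n ^ (M - 1) := by
  classical
  have hcard : #(univ.erase θ) = M - 1 := by
    rw [card_erase_of_mem (mem_univ _), card_univ, Fintype.card_fin]
  have h := Finset.sum_pow_mul_eq_add_pow (n - t) t (univ.erase θ)
  rw [hcard, Nat.sub_add_cancel htn] at h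
  rw [← h, ← Finset.sum_filter]
  refine (Finset.sum_bij' (fun s _ => insert θ s) (fun Λ _ => Λ.erase θ) ?_ ?_ ?_ ?_ ?_).symm
  · intro s _; simp
  · intro Λ _; exact mem_powerset.2 (erase_subset_erase _ (subset_univ _))
  · intro s hs
    exact erase_insert fun h => by simpa using mem_powerset.1 hs h
  · intro Λ hΛ
    exact insert_erase (mem_filter.1 hΛ).2
  · intro s hs
    rw [card_insert_of_notMem fun h => by simpa using mem_powerset.1 hs h]
    simp only [averageLoad, Nat.add_sub_cancel]
    congr 2
    omega

/-- The binomial theorem over all subsets, the empty one giving t ^ M. It computes the total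
download. -/
theorem sum_averageLoad (htn : t ≤ n) :
    (n - t) * ∑ Λ : Finset (Fin M), (if Λ = ∅ then 0 else averageLoad n t M #Λ) + t ^ M =
      n ^ M := by
  classical
  have h := Finset.sum_pow_mul_eq_add_pow (n - t) t (univ : Finset (Fin M))
  rw [card_univ, Fintype.card_fin, Nat.sub_add_cancel htn, Finset.powerset_univ] at h
  rw [← h, mul_sum, ← Finset.add_sum_erase univ _ (mem_univ (∅ : Finset (Fin M))),
    ← Finset.add_sum_erase univ (fun s : Finset (Fin M) => (n - t) ^ #s * t ^ (M - #s))
      (mem_univ (∅ : Finset (Fin M)))]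
  simp only [card_empty, pow_zero, one_mul, Nat.sub_zero, ite_true, mul_zero, zero_add]
  rw [add_comm]
  congr 1
  refine Finset.sum_congr rfl fun s hs => ?_
  have hs' := (mem_erase.1 hs).1
  rw [if_neg hs', averageLoad, ← mul_assoc, ← pow_succ',
    Nat.sub_add_cancel (card_pos.2 (nonempty_iff_ne_empty.2 hs'))]

theorem le_two_pow_of_logb_le {N μ e : ℕ} (hN : 2 ≤ N) (hμ : 1 < μ)
    (h : Real.logb (μ : ℝ) (Real.logb 2 (N : ℝ)) ≤ e) : N ≤ 2 ^ μ ^ e := by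
  have hN' : (2 : ℝ) ≤ N := by exact_mod_cast hN
  have h1 : 0 < Real.logb 2 (N : ℝ) := Real.logb_pos (by norm_num) (by linarith)
  rw [Real.logb_le_iff_le_rpow (by exact_mod_cast hμ) h1, Real.rpow_natCast,
    Real.logb_le_iff_le_rpow (by norm_num) (by linarith)] at h
  have h2 : (N : ℝ) ≤ 2 ^ μ ^ e := by
    rw [← Real.rpow_natCast]
    push_cast
    exact h
  exact_mod_cast h2

end Loads

/-! ### Probabilistic reformulations of correctness and privacy. -/

namespace PIRScheme

variable {F : Type} [Fintype F] {N M L : ℕ} (S : PIRScheme F N M L)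

theorem law_nonneg (ω : S.Sample) : 0 ≤ S.law ω :=
  mul_nonneg (mul_nonneg (by positivity) (S.prob_nonneg _)) (by positivity)

theorem sum_law_mul [Nonempty F] (G : Fin M → S.Rand → ℝ) :
    ∑ ω, S.law ω * G ω.1 ω.2.1 = ∑ θ, (M : ℝ)⁻¹ * ∑ s, S.prob s * G θ s := by
  have hc : (Fintype.card (Fin M → Fin L → F) : ℝ) ≠ 0 := by
    exact_mod_cast Fintype.card_ne_zero
  rw [Fintype.sum_prod_type]
  refine Finset.sum_congr rfl fun θ _ => ?_
  rw [Fintype.sum_prod_type, mul_sum]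
  refine Finset.sum_congr rfl fun s _ => ?_
  simp only [law, sum_const, card_univ, nsmul_eq_mul]
  field_simp

theorem sum_law [Nonempty F] (hM : 0 < M) : ∑ ω, S.law ω = 1 := by
  have h := S.sum_law_mul fun _ _ => 1
  have hM' : (M : ℝ) ≠ 0 := by exact_mod_cast hM.ne'
  simpa [S.prob_sum, hM'] using h

theorem exists_prob_pos {F : Type} (S : PIRScheme F N M L) : ∃ s, 0 < S.prob s := by
  by_contra! h
  have := Finset.sum_nonpos fun s (_ : s ∈ univ) => h s
  rw [S.prob_sum] at this
  linarith

/-- The uniform distribution of the records. -/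
noncomputable def recordLaw (F : Type) [Fintype F] (M L : ℕ) (_ : Fin M → Fin L → F) : ℝ :=
  ((Fintype.card (Fin M → Fin L → F) : ℕ) : ℝ)⁻¹

theorem recordLaw_pos [Nonempty F] (w : Fin M → Fin L → F) : 0 < recordLaw F M L w := by
  unfold recordLaw
  have : 0 < Fintype.card (Fin M → Fin L → F) := Fintype.card_pos
  positivity

theorem sum_recordLaw [Nonempty F] : ∑ w, recordLaw F M L w = 1 := by
  have hc : (Fintype.card (Fin M → Fin L → F) : ℝ) ≠ 0 := by
    exact_mod_cast Fintype.card_ne_zero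
  simp only [recordLaw, sum_const, card_univ, nsmul_eq_mul]
  exact mul_inv_cancel₀ hc

theorem law_eq (θ : Fin M) (s : S.Rand) (w : Fin M → Fin L → F) :
    S.law (θ, s, w) = (M : ℝ)⁻¹ * S.prob s * recordLaw F M L w := rfl

theorem probOf_pair_eq {α : Type*} (X : S.Sample → α) (θ : Fin M) (s : S.Rand) (x : α) :
    probOf S.law (fun ω => (X ω, (ω.1, ω.2.1))) (x, (θ, s)) =
      (M : ℝ)⁻¹ * S.prob s * probOf (recordLaw F M L) (fun w => X (θ, s, w)) x := by
  classical
  unfold probOf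
  rw [Fintype.sum_prod_type, Finset.sum_eq_single θ]
  · rw [Fintype.sum_prod_type, Finset.sum_eq_single s]
    · rw [mul_sum]
      refine Finset.sum_congr rfl fun w _ => ?_
      by_cases h : X (θ, s, w) = x <;> simp [h, law_eq]
    · intro s' _ hs'
      exact Finset.sum_eq_zero fun w _ => by simp [hs']
    · simp
  · intro θ' _ hθ'
    exact Finset.sum_eq_zero fun w _ => by simp [hθ']
  · simp

theorem probOf_choice_eq [Nonempty F] (θ : Fin M) (s : S.Rand) :
    probOf S.law (fun ω => (ω.1, ω.2.1)) (θ, s) = (M : ℝ)⁻¹ * S.prob s := by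
  have h := S.probOf_pair_eq (fun _ => ()) θ s ()
  rw [← sum_probOf_prod_left S.law (fun _ => ()) (fun ω => (ω.1, ω.2.1)) (θ, s)]
  simp only [univ_unique, sum_singleton]
  refine h.trans ?_
  simp [probOf, sum_recordLaw]

/-- The subtracted sum is the conditional entropy of X given the index and the resources; once these
are fixed, only the uniform records remain random. -/
theorem mutualInfo_choice [Nonempty F] (hM : 0 < M) {α : Type*} [Fintype α] (X : S.Sample → α) :
    mutualInfo S.law X (fun ω => (ω.1, ω.2.1)) = entropy S.law X -
      ∑ θ, (M : ℝ)⁻¹ * ∑ s, S.prob s * entropy (recordLaw F M L) (fun w => X (θ, s, w)) := by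
  have hM' : (0 : ℝ) < M := by exact_mod_cast hM
  have h : entropy S.law (fun ω => (X ω, (ω.1, ω.2.1))) -
      entropy S.law (fun ω => (ω.1, ω.2.1)) =
      ∑ θ, (M : ℝ)⁻¹ * ∑ s, S.prob s * entropy (recordLaw F M L) (fun w => X (θ, s, w)) := by
    simp only [entropy_eq_sum]
    rw [← Finset.sum_sub_distrib, Fintype.sum_prod_type]
    refine Finset.sum_congr rfl fun θ _ => ?_
    rw [Fintype.sum_prod_type, mul_sum]
    refine Finset.sum_congr rfl fun s _ => ?_
    rw [mul_sum, mul_sum]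
    refine Finset.sum_congr rfl fun w _ => ?_
    dsimp only
    rw [probOf_pair_eq, probOf_choice_eq, law_eq]
    rcases (S.prob_nonneg s).eq_or_lt with h0 | h0
    · simp [← h0]
    have h1 := (recordLaw_pos w).trans_le
      (le_probOf_self (fun w => (recordLaw_pos w).le) (fun w => X (θ, s, w)) w)
    rw [Real.log_mul (by positivity) h1.ne']
    ring
  rw [← h, mutualInfo]
  ring

theorem sum_entropy_recordLaw_le [Nonempty F] (hM : 0 < M) {α : Type*} [Fintype α]
    (X : S.Sample → α) :
    ∑ θ, (M : ℝ)⁻¹ * ∑ s, S.prob s * entropy (recordLaw F M L) (fun w => X (θ, s, w)) ≤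
      entropy S.law X := by
  have := mutualInfo_nonneg S.law_nonneg (S.sum_law hM) X (fun ω => (ω.1, ω.2.1))
  rw [S.mutualInfo_choice hM] at this
  linarith

/-- If conditioning on the choices of the user does not decrease the entropy, then the conditional
entropies are constant. -/
theorem entropy_recordLaw_eq [Nonempty F] (hM : 0 < M) {α : Type*} [Fintype α]
    (X : S.Sample → α)
    (h : ∑ θ, (M : ℝ)⁻¹ * ∑ s, S.prob s * entropy (recordLaw F M L) (fun w => X (θ, s, w)) =
      entropy S.law X) (θ : Fin M) {s : S.Rand} (hs : 0 < S.prob s) :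
    entropy (recordLaw F M L) (fun w => X (θ, s, w)) = entropy S.law X := by
  have hM' : (0 : ℝ) < M := by exact_mod_cast hM
  have h0 : mutualInfo S.law X (fun ω => (ω.1, ω.2.1)) = 0 := by
    rw [S.mutualInfo_choice hM, h, sub_self]
  rw [mutualInfo_eq_zero_iff S.law_nonneg (S.sum_law hM)] at h0
  refine Finset.sum_congr rfl fun x _ => ?_
  have h1 := h0 x (θ, s)
  rw [probOf_pair_eq, probOf_choice_eq, mul_comm (probOf S.law X x)] at h1
  rw [mul_left_cancel₀ (by positivity) h1]

theorem probOf_index [Nonempty F] (θ : Fin M) : probOf S.law S.index θ = (M : ℝ)⁻¹ := by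
  classical
  have h := S.sum_law_mul fun θ' _ => if θ' = θ then 1 else 0
  simp only [mul_ite, mul_one, mul_zero] at h
  refine Eq.trans ?_ (h.trans ?_)
  · unfold probOf
    refine Finset.sum_congr rfl fun ω _ => ?_
    by_cases hω : S.index ω = θ
    · rw [if_pos hω, if_pos (show ω.1 = θ from hω)]
    · rw [if_neg hω, if_neg (show ¬ω.1 = θ from hω)]
  · rw [Finset.sum_eq_single θ]
    · simp [S.prob_sum]
    · intro θ' _ h; simp [h]
    · simp

theorem entropy_desired [AddGroup F] (hM : 0 < M) :
    entropy S.law S.desired = L * Real.log (Fintype.card F) := by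
  classical
  have hconst : ∀ v v', probOf S.law S.desired v = probOf S.law S.desired v' := by
    intro v v'
    -- Translating all records preserves the law, so the desired record is uniform.
    let e : S.Sample ≃ S.Sample := Equiv.prodCongr (Equiv.refl _) (Equiv.prodCongr (Equiv.refl _)
      (Equiv.addRight fun _ => -v' + v))
    unfold probOf
    rw [← Equiv.sum_comp e]
    refine Finset.sum_congr rfl fun ω _ => ?_
    have h1 : S.law (e ω) = S.law ω := rfl
    have h2 : S.desired (e ω) = S.desired ω + (-v' + v) := rfl
    rw [h1, h2, ← add_assoc]
    have h3 : S.desired ω + -v' + v = v ↔ S.desired ω = v' := by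
      rw [add_eq_right, add_neg_eq_zero]
    by_cases h : S.desired ω = v'
    · rw [if_pos (h3.2 h), if_pos h]
    · rw [if_neg (mt h3.1 h), if_neg h]
  have hcard : (0 : ℝ) < Fintype.card (Fin L → F) := by exact_mod_cast Fintype.card_pos
  have hval : ∀ v, probOf S.law S.desired v = (Fintype.card (Fin L → F) : ℝ)⁻¹ := by
    intro v
    have h := sum_probOf S.law S.desired
    rw [S.sum_law hM, Finset.sum_congr rfl fun v' _ => hconst v' v] at h
    simp only [sum_const, card_univ, nsmul_eq_mul] at h
    exact eq_inv_of_mul_eq_one_right h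
  unfold entropy
  simp only [hval, Real.negMulLog, sum_const, card_univ, nsmul_eq_mul, Real.log_inv]
  rw [Fintype.card_fun, Fintype.card_fin] at *
  push_cast at *
  rw [Real.log_pow]
  field_simp

theorem isCorrect_of_decodable
    (h : ∀ θ s w w', (∀ j, S.ans j (S.que θ s j) w = S.ans j (S.que θ s j) w') → w θ = w' θ) :
    S.IsCorrect := by
  unfold IsCorrect condEntropy
  rw [entropy_pair_eq_of_determines S.law_nonneg, sub_self]
  rintro ⟨θ, s, w⟩ ⟨θ', s', w'⟩ heq
  simp only [Prod.mk.injEq, resources, index] at heq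
  obtain ⟨hA, -, rfl, rfl⟩ := heq
  exact h θ s w w' fun j => congrFun hA j

theorem eq_of_isCorrect [Nonempty F] (hS : S.IsCorrect) (hM : 0 < M) (θ : Fin M) {s : S.Rand}
    (hs : 0 < S.prob s) {w w' : Fin M → Fin L → F}
    (h : ∀ j, S.ans j (S.que θ s j) w = S.ans j (S.que θ s j) w') : w θ = w' θ := by
  have hM' : (0 : ℝ) < M := by exact_mod_cast hM
  have hpos : ∀ w, 0 < S.law (θ, s, w) := fun w => by
    rw [law_eq]
    exact mul_pos (mul_pos (by positivity) hs) (recordLaw_pos w)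
  refine eq_of_condEntropy_eq_zero S.law_nonneg hS (hpos w) (hpos w') ?_
  simp only [Prod.mk.injEq]
  exact ⟨funext h, rfl, rfl, rfl⟩

/-- A measure-preserving substitution of the resources that turns the queries to Γ for one index
into those for another makes the joint law of queries, answers and records independent of the index.
-/
theorem isPrivate_of_equiv [Nonempty F] (hM : 0 < M) {T : ℕ}
    (h : ∀ Γ : Finset (Fin N), #Γ = T → ∀ θ θ', ∃ g : S.Rand ≃ S.Rand,
      (∀ s, S.prob (g s) = S.prob s) ∧ ∀ s, ∀ j ∈ Γ, S.que θ' (g s) j = S.que θ s j) :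
    S.IsPrivate T := by
  classical
  intro Γ hΓ
  have hM' : (M : ℝ) ≠ 0 := by exact_mod_cast hM.ne'
  rw [mutualInfo_eq_zero_iff S.law_nonneg (S.sum_law hM)]
  set Z : S.Sample → ((∀ j : Γ, S.Query j) × (∀ j : Γ, S.Answer j) × (Fin M → Fin L → F)) :=
    fun ω => ((fun j : Γ => S.query j ω), (fun j : Γ => S.answer j ω), S.records ω)
  have hf : ∀ θ z, probOf S.law (fun ω => (S.index ω, Z ω)) (θ, z) =
      ∑ s, ∑ w, if Z (θ, s, w) = z then S.law (θ, s, w) else 0 := by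
    intro θ z
    unfold probOf
    rw [Fintype.sum_prod_type, Finset.sum_eq_single θ]
    · rw [Fintype.sum_prod_type]
      simp [index]
    · intro θ' _ hθ'
      exact Finset.sum_eq_zero fun w _ => by simp [index, hθ']
    · simp
  have hsymm : ∀ θ θ' z, probOf S.law (fun ω => (S.index ω, Z ω)) (θ, z) =
      probOf S.law (fun ω => (S.index ω, Z ω)) (θ', z) := by
    intro θ θ' z
    obtain ⟨g, hg, hq⟩ := h Γ hΓ θ θ'
    rw [hf, hf, ← Equiv.sum_comp g
      (fun s => ∑ w, if Z (θ', s, w) = z then S.law (θ', s, w) else 0)]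
    refine Finset.sum_congr rfl fun s _ => Finset.sum_congr rfl fun w _ => ?_
    have h1 : Z (θ', g s, w) = Z (θ, s, w) := by
      simp only [Z, Prod.mk.injEq]
      refine ⟨funext fun j => hq s j j.2, funext fun j => ?_, rfl⟩
      simp only [answer, query, index, resources, records]
      rw [hq s j j.2]
    rw [h1, law_eq, law_eq, hg]
  intro θ z
  have hz : probOf S.law Z z = M * probOf S.law (fun ω => (S.index ω, Z ω)) (θ, z) := by
    rw [← sum_probOf_prod_left S.law S.index Z z, Finset.sum_congr rfl fun θ' _ => hsymm θ' θ z]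
    simp
  rw [probOf_index, hz, ← mul_assoc, inv_mul_cancel₀ hM', one_mul]

/-- The expectation of a function of the queries, when record `θ` is desired. -/
noncomputable def queryMean (θ : Fin M) (φ : (∀ j, S.Query j) → ℝ) : ℝ :=
  ∑ s, S.prob s * φ (S.que θ s)

/-- This is how privacy enters the converse: the mean of anything that depends only on the queries
to T servers is the same for all desired records. -/
theorem queryMean_eq_of_isPrivate [Nonempty F] (hM : 0 < M) {T : ℕ} (hS : S.IsPrivate T)
    {Γ : Finset (Fin N)} (hΓ : #Γ = T) {φ : (∀ j, S.Query j) → ℝ}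
    (hφ : ∀ x x', (∀ j ∈ Γ, x j = x' j) → φ x = φ x') (θ θ' : Fin M) :
    S.queryMean θ φ = S.queryMean θ' φ := by
  classical
  have hM' : (M : ℝ) ≠ 0 := by exact_mod_cast hM.ne'
  have h0 := hS Γ hΓ
  rw [mutualInfo_eq_zero_iff S.law_nonneg (S.sum_law hM)] at h0
  set Z : S.Sample → ((∀ j : Γ, S.Query j) × (∀ j : Γ, S.Answer j) × (Fin M → Fin L → F)) :=
    fun ω => ((fun j : Γ => S.query j ω), (fun j : Γ => S.answer j ω), S.records ω)
  have h0 : ∀ θ z, probOf S.law (fun ω => (S.index ω, Z ω)) (θ, z) =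
      probOf S.law S.index θ * probOf S.law Z z := h0
  let r : (∀ j, S.Query j) → (∀ j : Γ, S.Query j) := fun x j => x j
  have hr : Function.FactorsThrough φ r := fun x x' hx =>
    hφ x x' fun j hj => congrFun hx ⟨j, hj⟩
  let φ' : (∀ j : Γ, S.Query j) → ℝ := Function.extend r φ 0
  have hφ' : ∀ x, φ' (r x) = φ x := hr.extend_apply 0
  have key : ∀ θ, S.queryMean θ φ = ∑ z, probOf S.law Z z * φ' z.1 := by
    intro θ
    have h1 := sum_probOf_mul S.law (fun ω => (S.index ω, Z ω))
      (fun i => if i.1 = θ then φ' i.2.1 else 0)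
    have h2 := S.sum_law_mul fun θ' s => if θ' = θ then φ (S.que θ' s) else 0
    have h3 : ∑ ω, S.law ω * (if S.index ω = θ then φ' (Z ω).1 else 0) =
        ∑ ω, S.law ω * (if ω.1 = θ then φ (S.que ω.1 ω.2.1) else 0) := by
      refine Finset.sum_congr rfl fun ω _ => ?_
      rw [← hφ' (S.que ω.1 ω.2.1)]
      rfl
    rw [h3, h2, Fintype.sum_prod_type, Finset.sum_eq_single θ, Finset.sum_eq_single θ] at h1
    · simp only [ite_true, h0, probOf_index, mul_assoc, ← mul_sum] at h1
      exact (mul_left_cancel₀ (inv_ne_zero hM') h1).symm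
    · intro θ' _ hθ'; simp [hθ']
    · simp
    · intro θ' _ hθ'; simp [hθ']
    · simp
  rw [key, key]

end PIRScheme

/-! ### Han's inequality and its equality case. -/

section Polymatroid

variable {N : ℕ}

/-- The greedy vector of a submodular set function lies in its base polytope. -/
theorem exists_base_of_submodular (f : Finset (Fin N) → ℝ) (h0 : f ∅ = 0)
    (hf : ∀ Γ Γ' j, Γ ⊆ Γ' → f (insert j Γ') - f Γ' ≤ f (insert j Γ) - f Γ) :
    ∃ g : Fin N → ℝ, (∀ Γ, ∑ j ∈ Γ, g j ≤ f Γ) ∧ ∑ j, g j = f univ ∧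
      ∀ j, ∃ Γ₁ Γ₂, g j = f Γ₁ - f Γ₂ := by
  -- The greedy vector consists of successive increments of f along the chain of initial segments.
  -- Being a difference of two values of f, each entry is later integral for linear schemes.
  refine ⟨fun j => f (Iic j) - f (Iio j), fun Γ => ?_, ?_, fun j => ⟨_, _, rfl⟩⟩
  · induction Γ using Finset.induction_on_max with
    | empty => simp [h0]
    | insert a s hs ih =>
      rw [sum_insert fun h => lt_irrefl a (hs a h)]
      have := hf s (Iio a) a fun x hx => mem_Iio.2 (hs x hx)
      rw [Iio_insert] at this
      linarith
  · let G : ℕ → ℝ := fun k => f (univ.filter fun i : Fin N => (i : ℕ) < k)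
    have h1 : ∀ j : Fin N, f (Iic j) - f (Iio j) = G (j + 1) - G j := by
      intro j
      simp only [G]
      congr 2
      · ext i
        simp only [mem_Iic, mem_filter, mem_univ, true_and, Fin.le_def]
        omega
      · ext i
        simp only [mem_Iio, mem_filter, mem_univ, true_and, Fin.lt_def]
    rw [Finset.sum_congr rfl fun j _ => h1 j,
      Fin.sum_univ_eq_sum_range (fun k => G (k + 1) - G k) N, Finset.sum_range_sub]
    have h2 : G N = f univ := by simp [G]
    have h3 : G 0 = 0 := by simp [G, h0]
    rw [h2, h3, sub_zero]

theorem sum_powersetCard_sum (T : ℕ) (hT : 1 ≤ T) (hTN : T ≤ N) (g : Fin N → ℝ) :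
    (N : ℝ) * ∑ Γ ∈ powersetCard T univ, ∑ j ∈ Γ, g j =
      T * #(powersetCard T (univ : Finset (Fin N))) * ∑ j, g j := by
  classical
  have hcount : ∀ j : Fin N, #((powersetCard T univ).filter (j ∈ ·)) = (N - 1).choose (T - 1) := by
    intro j
    have := Finset.card_filter_powersetCard_subset {j} univ T (subset_univ _) (by simpa using hT)
    simpa using this
  have h1 : ∑ Γ ∈ powersetCard T univ, ∑ j ∈ Γ, g j = (N - 1).choose (T - 1) * ∑ j, g j := by
    rw [Finset.sum_comm' (t' := univ) (s' := fun j => (powersetCard T univ).filter (j ∈ ·))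
      (by intro Γ j; simp), mul_sum]
    refine Finset.sum_congr rfl fun j _ => ?_
    rw [sum_const, hcount, nsmul_eq_mul]
  have h2 : N * (N - 1).choose (T - 1) = #(powersetCard T (univ : Finset (Fin N))) * T := by
    obtain ⟨t, rfl⟩ := Nat.exists_eq_add_of_le' hT
    obtain ⟨m, rfl⟩ := Nat.exists_eq_add_of_le' (hT.trans hTN)
    simpa using Nat.add_one_mul_choose_eq m t
  rw [h1, ← mul_assoc, ← Nat.cast_mul, h2]
  push_cast
  ring

/-- A vector all of whose sums over sets of `T` indices agree is constant. -/
theorem eq_of_sum_powersetCard_eq {T : ℕ} (hT : 1 ≤ T) (hTN : T < N) {g : Fin N → ℝ} {c : ℝ}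
    (h : ∀ Γ : Finset (Fin N), #Γ = T → ∑ j ∈ Γ, g j = c) (i j : Fin N) : g i = g j := by
  rcases eq_or_ne i j with rfl | hij
  · rfl
  have hcard : #((univ.erase i).erase j) = N - 2 := by
    rw [card_erase_of_mem (by simp [hij.symm]), card_erase_of_mem (mem_univ _), card_univ,
      Fintype.card_fin]
    omega
  -- Compare two sets of T indices that differ only by exchanging i and j; T < N leaves room for T -
  -- 1 common indices.
  obtain ⟨Γ, hΓ, hΓc⟩ := Finset.exists_subset_card_eq (show T - 1 ≤ #((univ.erase i).erase j) by
    omega)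
  have hi : i ∉ Γ := fun hi => by simpa using hΓ hi
  have hj : j ∉ Γ := fun hj => by simpa using hΓ hj
  have h1 := h (insert i Γ) (by rw [card_insert_of_notMem hi]; omega)
  have h2 := h (insert j Γ) (by rw [card_insert_of_notMem hj]; omega)
  rw [sum_insert hi] at h1
  rw [sum_insert hj] at h2
  linarith

/-- Han's inequality. -/
theorem card_mul_le_sum_of_submodular {T : ℕ} (hT : 1 ≤ T) (hTN : T ≤ N)
    {f : Finset (Fin N) → ℝ} (h0 : f ∅ = 0)
    (hf : ∀ Γ Γ' j, Γ ⊆ Γ' → f (insert j Γ') - f Γ' ≤ f (insert j Γ) - f Γ) :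
    T * #(powersetCard T (univ : Finset (Fin N))) * f univ ≤
      N * ∑ Γ ∈ powersetCard T univ, f Γ := by
  obtain ⟨g, hg, hgu, -⟩ := exists_base_of_submodular f h0 hf
  rw [← hgu, ← sum_powersetCard_sum T hT hTN]
  exact mul_le_mul_of_nonneg_left (sum_le_sum fun Γ _ => hg Γ) (Nat.cast_nonneg _)

/-- The case of equality in Han's inequality, for a function that is constant on the sets of `T`
indices. -/
theorem eq_of_card_mul_eq_sum {T : ℕ} (hT : 1 ≤ T) (hTN : T < N)
    {f : Finset (Fin N) → ℝ} (h0 : f ∅ = 0)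
    (hf : ∀ Γ Γ' j, Γ ⊆ Γ' → f (insert j Γ') - f Γ' ≤ f (insert j Γ) - f Γ)
    (heq : T * #(powersetCard T (univ : Finset (Fin N))) * f univ =
      N * ∑ Γ ∈ powersetCard T univ, f Γ) {c : ℝ}
    (hc : ∀ Γ : Finset (Fin N), #Γ = T → f Γ = c) :
    ∃ Γ₁ Γ₂, c = T * (f Γ₁ - f Γ₂) ∧ f univ = N * (f Γ₁ - f Γ₂) := by
  obtain ⟨g, hg, hgu, hgd⟩ := exists_base_of_submodular f h0 hf
  have hN : (0 : ℝ) < N := by exact_mod_cast (by omega : 0 < N)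
  rw [← hgu, ← sum_powersetCard_sum T hT hTN.le] at heq
  have heq' := (Finset.sum_eq_sum_iff_of_le fun Γ _ => hg Γ).1 (mul_left_cancel₀ hN.ne' heq)
  have hsum : ∀ Γ : Finset (Fin N), #Γ = T → ∑ j ∈ Γ, g j = c := fun Γ hΓ => by
    rw [heq' Γ (mem_powersetCard_univ.2 hΓ), hc Γ hΓ]
  have hconst := eq_of_sum_powersetCard_eq hT hTN hsum
  let j₀ : Fin N := ⟨0, by omega⟩
  obtain ⟨Γ₁, Γ₂, hΓ⟩ := hgd j₀
  refine ⟨Γ₁, Γ₂, ?_, ?_⟩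
  · obtain ⟨Γ, -, hcard⟩ := Finset.exists_subset_card_eq (show T ≤ #(univ : Finset (Fin N)) by
      simpa using hTN.le)
    rw [← hsum Γ hcard, Finset.sum_congr rfl fun j _ => hconst j j₀, hΓ,
      sum_const, hcard, nsmul_eq_mul]
  · rw [← hgu, Finset.sum_congr rfl fun j _ => hconst j j₀, hΓ, sum_const, card_univ,
      Fintype.card_fin, nsmul_eq_mul]

end Polymatroid

/-! ### Residual entropies of the answers for fixed queries. -/

namespace PIRScheme

/-- The entropy of a linear function of the records. -/
theorem entropy_linearMap {F : Type} [Field F] [Fintype F] {M L : ℕ} {U : Type*} [AddCommGroup U]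
    [Module F U] [Fintype U] (φ : (Fin M → Fin L → F) →ₗ[F] U) :
    entropy (recordLaw F M L) φ =
      (Module.finrank F (LinearMap.range φ) : ℕ) * Real.log (Fintype.card F) := by
  classical
  have hq : (0 : ℝ) < Fintype.card F := by exact_mod_cast Fintype.card_pos
  have hker : ∀ w, probOf (recordLaw F M L) φ (φ w) =
      (Fintype.card F : ℝ) ^ (Module.finrank F (LinearMap.ker φ)) *
        ((Fintype.card F : ℝ) ^ (Module.finrank F (Fin M → Fin L → F)))⁻¹ := by
    intro w
    have h1 : Fintype.card (LinearMap.ker φ) = #(univ.filter fun w' => φ w' = φ w) := by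
      rw [← Fintype.card_subtype]
      refine Fintype.card_congr ⟨fun u => ⟨u + w, by simp [LinearMap.mem_ker.1 u.2]⟩,
        fun u => ⟨u - w, by simp [u.2]⟩, fun u => by simp, fun u => by simp⟩
    rw [← Nat.cast_pow, ← Nat.cast_pow, ← Module.card_eq_pow_finrank,
      ← Module.card_eq_pow_finrank, h1]
    unfold probOf recordLaw
    rw [← Finset.sum_filter, sum_const, nsmul_eq_mul]
  rw [entropy_eq_sum]
  simp only [hker]
  rw [← sum_mul, sum_recordLaw, one_mul, Real.log_mul (by positivity) (by positivity),
    Real.log_inv, Real.log_pow, Real.log_pow, ← φ.finrank_range_add_finrank_ker]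
  push_cast
  ring

variable {F : Type} {N M L : ℕ} (S : PIRScheme F N M L)

/-- The records in `Λ` and the answers of the servers in `Γ` to the queries `x`. -/
noncomputable def view (x : ∀ j, S.Query j) (Γ : Finset (Fin N)) (Λ : Finset (Fin M))
    (w : Fin M → Fin L → F) : (∀ j, Option (S.Answer j)) × (Fin M → Option (Fin L → F)) :=
  (fun j => if j ∈ Γ then some (S.ans j (x j) w) else none,
    fun m => if m ∈ Λ then some (w m) else none)

theorem view_eq_iff {x : ∀ j, S.Query j} {Γ : Finset (Fin N)} {Λ : Finset (Fin M)}
    {w w' : Fin M → Fin L → F} : S.view x Γ Λ w = S.view x Γ Λ w' ↔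
      (∀ j ∈ Γ, S.ans j (x j) w = S.ans j (x j) w') ∧ ∀ m ∈ Λ, w m = w' m := by
  simp only [view, Prod.mk.injEq, funext_iff (β := fun j => Option (S.Answer j)),
    funext_iff (β := fun _ => Option (Fin L → F))]
  refine and_congr (forall_congr' fun j => ?_) (forall_congr' fun m => ?_)
  · by_cases h : j ∈ Γ <;> simp [h]
  · by_cases h : m ∈ Λ <;> simp [h]

variable [Field F] [Fintype F]

/-- The conditional entropy of the answers of the servers in `Γ` to the queries `x`, given the
records in `Λ`. -/
noncomputable def residual (x : ∀ j, S.Query j) (Γ : Finset (Fin N)) (Λ : Finset (Fin M)) : ℝ :=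
  entropy (recordLaw F M L) (S.view x Γ Λ) - #Λ * (L * Real.log (Fintype.card F))

theorem recordLaw_nonneg (w : Fin M → Fin L → F) : 0 ≤ recordLaw F M L w := (recordLaw_pos w).le

theorem residual_congr {F : Type} [Fintype F] (S : PIRScheme F N M L) {x x' : ∀ j, S.Query j}
    {Γ : Finset (Fin N)} (h : ∀ j ∈ Γ, x j = x' j)
    (Λ : Finset (Fin M)) : S.residual x Γ Λ = S.residual x' Γ Λ := by
  have : S.view x Γ Λ = S.view x' Γ Λ := by
    funext w
    simp only [view, Prod.mk.injEq, and_true]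
    funext j
    by_cases hj : j ∈ Γ
    · simp [hj, h j hj]
    · simp [hj]
  rw [residual, residual, this]

theorem residual_mono (x : ∀ j, S.Query j) {Γ Γ' : Finset (Fin N)} (h : Γ ⊆ Γ')
    (Λ : Finset (Fin M)) : S.residual x Γ Λ ≤ S.residual x Γ' Λ := by
  refine sub_le_sub_right (entropy_le_of_determines recordLaw_nonneg fun w w' hw => ?_) _
  rw [view_eq_iff] at hw ⊢
  exact ⟨fun j hj => hw.1 j (h hj), hw.2⟩

theorem residual_empty (x : ∀ j, S.Query j) (Λ : Finset (Fin M)) : S.residual x ∅ Λ = 0 := by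
  let φ : (Fin M → Fin L → F) →ₗ[F] (Λ → Fin L → F) := LinearMap.funLeft F (Fin L → F) (↑)
  have h1 : entropy (recordLaw F M L) (S.view x ∅ Λ) = entropy (recordLaw F M L) φ := by
    refine entropy_eq_of_kernel recordLaw_nonneg fun w w' => ?_
    rw [view_eq_iff]
    simp [φ, funext_iff, LinearMap.funLeft]
  have h2 : LinearMap.range φ = ⊤ :=
    LinearMap.range_eq_top.2 (LinearMap.funLeft_surjective_of_injective _ _ _
      Subtype.val_injective)
  rw [residual, h1, entropy_linearMap, h2, finrank_top, Module.finrank_pi_fintype]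
  simp [mul_assoc]

/-- Entropy submodularity for the answer of server j and the view of Γ', conditioned on the view of
Γ, which the view of Γ' determines. -/
theorem residual_submodular (x : ∀ j, S.Query j) (Λ : Finset (Fin M)) (Γ Γ' : Finset (Fin N))
    (j : Fin N) (h : Γ ⊆ Γ') :
    S.residual x (insert j Γ') Λ - S.residual x Γ' Λ ≤
      S.residual x (insert j Γ) Λ - S.residual x Γ Λ := by
  have key := entropy_submodular (p := recordLaw F M L) recordLaw_nonneg
    (fun w => S.ans j (x j) w) (S.view x Γ' Λ) (S.view x Γ Λ)
  have h1 : entropy (recordLaw F M L) (S.view x (insert j Γ') Λ) = entropy (recordLaw F M L)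
      (fun w => (S.ans j (x j) w, S.view x Γ' Λ w, S.view x Γ Λ w)) := by
    refine entropy_eq_of_kernel recordLaw_nonneg fun w w' => ?_
    simp only [Prod.mk.injEq, view_eq_iff, mem_insert, forall_eq_or_imp]
    exact ⟨fun ⟨a, b, _⟩ => ⟨⟨a, b.1⟩, b.2⟩,
      fun ⟨⟨a, b⟩, c⟩ => ⟨a, ⟨b, c⟩, fun i hi => b i (h hi), c⟩⟩
  have h2 : entropy (recordLaw F M L) (S.view x (insert j Γ) Λ) = entropy (recordLaw F M L)
      (fun w => (S.ans j (x j) w, S.view x Γ Λ w)) := by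
    refine entropy_eq_of_kernel recordLaw_nonneg fun w w' => ?_
    simp only [Prod.mk.injEq, view_eq_iff, mem_insert, forall_eq_or_imp, and_assoc]
  have h3 : entropy (recordLaw F M L) (S.view x Γ' Λ) = entropy (recordLaw F M L)
      (fun w => (S.view x Γ' Λ w, S.view x Γ Λ w)) := by
    refine entropy_eq_of_kernel recordLaw_nonneg fun w w' => ?_
    simp only [Prod.mk.injEq, view_eq_iff]
    exact ⟨And.left, fun a => ⟨a, fun i hi => a.1 i (h hi), a.2⟩⟩
  simp only [residual]
  linarith

theorem residual_singleton (x : ∀ j, S.Query j) (j : Fin N) :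
    S.residual x {j} ∅ = entropy (recordLaw F M L) (fun w => S.ans j (x j) w) := by
  rw [residual, card_empty, Nat.cast_zero, zero_mul, sub_zero]
  refine entropy_eq_of_kernel recordLaw_nonneg fun w w' => ?_
  simp [view_eq_iff]

/-- All answers determine the desired record, so adding it to the view leaves the entropy unchanged,
while the subtracted entropy of the known records grows by that of one record. -/
theorem residual_univ_eq_add (hS : S.IsCorrect) (hM : 0 < M) {θ : Fin M} {s : S.Rand}
    (hs : 0 < S.prob s) {Λ : Finset (Fin M)} (hθ : θ ∉ Λ) :
    S.residual (S.que θ s) univ Λ =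
      L * Real.log (Fintype.card F) + S.residual (S.que θ s) univ (insert θ Λ) := by
  have h : entropy (recordLaw F M L) (S.view (S.que θ s) univ (insert θ Λ)) =
      entropy (recordLaw F M L) (S.view (S.que θ s) univ Λ) := by
    refine entropy_eq_of_kernel recordLaw_nonneg fun w w' => ?_
    simp only [view_eq_iff, mem_univ, true_implies, mem_insert, forall_eq_or_imp]
    exact ⟨fun a => ⟨a.1, S.eq_of_isCorrect hS hM θ hs a.1, a.2⟩, fun a => ⟨a.1, a.2.2⟩⟩
  rw [residual, residual, h, card_insert_of_notMem hθ]
  push_cast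
  ring

theorem residual_univ_univ (x : ∀ j, S.Query j) : S.residual x univ univ = 0 := by
  rw [← S.residual_empty x univ]
  refine congrArg (· - _) (entropy_eq_of_kernel recordLaw_nonneg fun w w' => ?_)
  simp only [view_eq_iff, mem_univ, true_implies, notMem_empty, false_implies, implies_true,
    true_and]
  exact ⟨fun a => ⟨fun j => by rw [funext a], a⟩, And.right⟩

theorem residual_le_sum (x : ∀ j, S.Query j) (Λ : Finset (Fin M)) (Γ : Finset (Fin N)) :
    S.residual x Γ Λ ≤ ∑ j ∈ Γ, S.residual x {j} Λ := by
  induction Γ using Finset.induction_on with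
  | empty => simp [residual_empty]
  | insert j Γ hj ih =>
    have := S.residual_submodular x Λ ∅ Γ j (empty_subset _)
    rw [residual_empty, insert_empty_eq] at this
    rw [sum_insert hj]
    linarith

/-- For a linear scheme the view has the same fibres as a linear map, whose entropy is its rank
times log q. This integrality is the only use of linearity in the lower bound on L. -/
theorem exists_residual_eq_of_isLinear (hS : S.IsLinear) (x : ∀ j, S.Query j)
    (Γ : Finset (Fin N)) (Λ : Finset (Fin M)) :
    ∃ z : ℤ, S.residual x Γ Λ = z * Real.log (Fintype.card F) := by
  obtain ⟨d, e, he⟩ := hS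
  let φ : (Fin M → Fin L → F) →ₗ[F] (∀ j : Γ, Fin (d j) → F) × (Λ → Fin L → F) :=
    (LinearMap.pi fun j : Γ => (he j (x j)).mk').prod
      (LinearMap.funLeft F (Fin L → F) (Subtype.val : Λ → Fin M))
  have h1 : entropy (recordLaw F M L) (S.view x Γ Λ) = entropy (recordLaw F M L) φ := by
    refine entropy_eq_of_kernel recordLaw_nonneg fun w w' => ?_
    rw [view_eq_iff]
    simp [φ, funext_iff (β := fun _ => Fin L → F), LinearMap.funLeft,
      funext_iff (β := fun j : Γ => Fin (d j) → F)]
  refine ⟨Module.finrank F (LinearMap.range φ) - #Λ * L, ?_⟩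
  rw [residual, h1, entropy_linearMap]
  push_cast
  ring

end PIRScheme

/-! ### The capacity bound. -/

namespace PIRScheme

variable {F : Type} {N M L : ℕ} (S : PIRScheme F N M L)

theorem queryMean_mono (θ : Fin M) {φ ψ : (∀ j, S.Query j) → ℝ} (h : ∀ x, φ x ≤ ψ x) :
    S.queryMean θ φ ≤ S.queryMean θ ψ :=
  sum_le_sum fun s _ => mul_le_mul_of_nonneg_left (h _) (S.prob_nonneg s)

theorem queryMean_congr (θ : Fin M) {φ ψ : (∀ j, S.Query j) → ℝ}
    (h : ∀ s, 0 < S.prob s → φ (S.que θ s) = ψ (S.que θ s)) :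
    S.queryMean θ φ = S.queryMean θ ψ :=
  Finset.sum_congr rfl fun s _ => by
    rcases (S.prob_nonneg s).eq_or_lt with h0 | h0
    · simp [← h0]
    · rw [h s h0]

theorem eq_of_queryMean_eq (θ : Fin M) {φ ψ : (∀ j, S.Query j) → ℝ} (h : ∀ x, φ x ≤ ψ x)
    (heq : S.queryMean θ φ = S.queryMean θ ψ) {s : S.Rand} (hs : 0 < S.prob s) :
    φ (S.que θ s) = ψ (S.que θ s) :=
  mul_left_cancel₀ hs.ne' ((Finset.sum_eq_sum_iff_of_le fun s _ =>
    mul_le_mul_of_nonneg_left (h (S.que θ s)) (S.prob_nonneg s)).1 heq s (mem_univ s))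

theorem queryMean_sum {ι : Type*} (θ : Fin M) (I : Finset ι) (φ : ι → (∀ j, S.Query j) → ℝ) :
    S.queryMean θ (fun x => ∑ i ∈ I, φ i x) = ∑ i ∈ I, S.queryMean θ (φ i) := by
  simp only [queryMean, mul_sum]
  exact Finset.sum_comm

theorem queryMean_const_mul (θ : Fin M) (c : ℝ) (φ : (∀ j, S.Query j) → ℝ) :
    S.queryMean θ (fun x => c * φ x) = c * S.queryMean θ φ := by
  simp only [queryMean, mul_sum]
  exact Finset.sum_congr rfl fun s _ => by ring

theorem queryMean_const (θ : Fin M) (c : ℝ) : S.queryMean θ (fun _ => c) = c := by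
  rw [queryMean, ← sum_mul, S.prob_sum, one_mul]

theorem queryMean_const_add (θ : Fin M) (c : ℝ) (φ : (∀ j, S.Query j) → ℝ) :
    S.queryMean θ (fun x => c + φ x) = c + S.queryMean θ φ := by
  rw [← S.queryMean_const θ c]
  simp only [queryMean, mul_add, sum_add_distrib, ← sum_mul, S.prob_sum, one_mul]

/-- The first `k` records. -/
def initial (M k : ℕ) : Finset (Fin M) := univ.filter fun i => (i : ℕ) < k

theorem initial_zero : initial M 0 = ∅ := by simp [initial]

theorem initial_self : initial M M = univ := by simp [initial]

theorem insert_initial {k : ℕ} (hk : k < M) :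
    insert ⟨k, hk⟩ (initial M k) = initial M (k + 1) := by
  ext i
  simp only [initial, mem_insert, mem_filter, mem_univ, true_and, Fin.ext_iff]
  omega

theorem notMem_initial {k : ℕ} (hk : k < M) : (⟨k, hk⟩ : Fin M) ∉ initial M k := by
  simp [initial]

variable [Field F] [Fintype F]

/-- The mean conditional entropy of all answers given the first `k` records, when the next record
is desired. -/
noncomputable def meanResidual (k : ℕ) (hk : k < M) : ℝ :=
  S.queryMean ⟨k, hk⟩ fun x => S.residual x univ (initial M k)

variable {S} {T : ℕ}

theorem meanResidual_eq_add (hS : S.IsCorrect) {k : ℕ} (hk : k < M) :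
    S.meanResidual k hk = L * Real.log (Fintype.card F) +
      S.queryMean ⟨k, hk⟩ fun x => S.residual x univ (initial M (k + 1)) := by
  rw [← queryMean_const_add]
  refine S.queryMean_congr _ fun s hs => ?_
  rw [S.residual_univ_eq_add hS (by omega) hs (notMem_initial hk), insert_initial]

theorem queryMean_residual_eq (hS : S.IsPrivate T) {Γ : Finset (Fin N)} (hΓ : #Γ = T)
    (Λ : Finset (Fin M)) (θ θ' : Fin M) :
    S.queryMean θ (fun x => S.residual x Γ Λ) = S.queryMean θ' (fun x => S.residual x Γ Λ) :=
  S.queryMean_eq_of_isPrivate (Fin.pos θ) hS hΓ (fun _ _ h => S.residual_congr h Λ) θ θ'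

theorem sum_residual_le (x : ∀ j, S.Query j) (Λ : Finset (Fin M)) :
    ∑ Γ ∈ powersetCard T univ, S.residual x Γ Λ ≤
      #(powersetCard T (univ : Finset (Fin N))) * S.residual x univ Λ := by
  rw [← nsmul_eq_mul, ← sum_const]
  exact sum_le_sum fun Γ _ => S.residual_mono x (subset_univ Γ) Λ

theorem card_powersetCard_pos (hTN : T ≤ N) :
    (0 : ℝ) < #(powersetCard T (univ : Finset (Fin N))) := by
  rw [card_powersetCard, card_univ, Fintype.card_fin]
  exact_mod_cast Nat.choose_pos hTN

theorem card_mul_residual_le_sum (hT : 1 ≤ T) (hTN : T ≤ N) (x : ∀ j, S.Query j)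
    (Λ : Finset (Fin M)) :
    T * #(powersetCard T (univ : Finset (Fin N))) * S.residual x univ Λ ≤
      N * ∑ Γ ∈ powersetCard T univ, S.residual x Γ Λ :=
  card_mul_le_sum_of_submodular (f := fun Γ => S.residual x Γ Λ) hT hTN (S.residual_empty x Λ)
    (S.residual_submodular x Λ)

/-- With record k + 1 desired, Han's inequality passes from all servers to averages over T servers;
privacy replaces the desired record by k; monotonicity returns to all servers, where decoding record
k accounts for L log q. -/
theorem mul_meanResidual_succ_le (hS : S.IsTPIR T) (hT : 1 ≤ T) (hTN : T ≤ N) {k : ℕ}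
    (hk : k + 1 < M) :
    T * S.meanResidual (k + 1) hk ≤
      N * (S.meanResidual k (by omega) - L * Real.log (Fintype.card F)) := by
  have hP := card_powersetCard_pos hTN
  have h1 : S.queryMean ⟨k + 1, hk⟩ (fun x => T * #(powersetCard T (univ : Finset (Fin N))) *
      S.residual x univ (initial M (k + 1))) ≤ S.queryMean ⟨k + 1, hk⟩
      (fun x => N * ∑ Γ ∈ powersetCard T univ, S.residual x Γ (initial M (k + 1))) :=
    S.queryMean_mono _ fun x => card_mul_residual_le_sum hT hTN x _
  have h2 := S.queryMean_mono (⟨k, by omega⟩ : Fin M) fun x =>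
    sum_residual_le (T := T) x (initial M (k + 1))
  rw [queryMean_const_mul, queryMean_const_mul, queryMean_sum] at h1
  rw [queryMean_sum, queryMean_const_mul, Finset.sum_congr rfl fun Γ hΓ =>
    queryMean_residual_eq hS.2 (mem_powersetCard_univ.1 hΓ) _ _ ⟨k + 1, hk⟩] at h2
  rw [meanResidual_eq_add hS.1 (by omega : k < M), add_sub_cancel_left]
  have h3 := h1.trans (mul_le_mul_of_nonneg_left h2 (Nat.cast_nonneg N))
  refine le_of_mul_le_mul_left ?_ hP
  refine le_trans (le_of_eq ?_) (h3.trans_eq ?_)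
  · rw [meanResidual]; ring
  · ring

theorem meanResidual_last (hS : S.IsCorrect) {k : ℕ} (hk : k + 1 = M) :
    S.meanResidual k (by omega) = L * Real.log (Fintype.card F) := by
  rw [meanResidual_eq_add hS, hk, initial_self]
  simp only [residual_univ_univ, queryMean_const, add_zero]

theorem mul_sum_pow_le_meanResidual (hS : S.IsTPIR T) (hT : 1 ≤ T) (hTN : T ≤ N) {k : ℕ}
    (hk : k < M) :
    L * Real.log (Fintype.card F) * ∑ i ∈ range (M - k), ((T : ℝ) / N) ^ i ≤
      S.meanResidual k hk := by
  have hN : (0 : ℝ) < N := by exact_mod_cast (by omega : 0 < N)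
  induction h : M - k generalizing k with
  | zero => omega
  | succ c ih =>
    rcases Nat.eq_zero_or_pos c with rfl | hc
    · rw [meanResidual_last hS.1 (by omega)]
      simp
    · have h1 := ih (k := k + 1) (by omega) (by omega)
      have h2 := mul_meanResidual_succ_le hS hT hTN (k := k) (by omega)
      have h3 : (T : ℝ) / N * S.meanResidual (k + 1) (by omega) ≤
          S.meanResidual k hk - L * Real.log (Fintype.card F) := by
        rw [div_mul_eq_mul_div, div_le_iff₀ hN]
        linarith
      have h4 := mul_le_mul_of_nonneg_left h1 (by positivity : (0 : ℝ) ≤ (T : ℝ) / N)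
      rw [sum_range_succ']
      simp only [pow_succ, ← sum_mul, pow_zero]
      linarith

theorem queryMean_singleton_eq (hS : S.IsPrivate T) (hT : 1 ≤ T) (hTN : T ≤ N) (j : Fin N)
    (θ θ' : Fin M) : S.queryMean θ (fun x => S.residual x {j} ∅) =
      S.queryMean θ' (fun x => S.residual x {j} ∅) := by
  obtain ⟨Γ, hjΓ, -, hΓ⟩ := Finset.exists_subsuperset_card_eq (subset_univ {j})
    (by simpa using hT) (by simpa using hTN)
  exact S.queryMean_eq_of_isPrivate (Fin.pos θ) hS hΓ (fun _ _ h => S.residual_congr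
    (fun i hi => h i (hjΓ hi)) ∅) θ θ'

/-- Conditioning on the choices of the user does not increase the entropy of an answer, and by
privacy the conditional mean is the same for every desired record. -/
theorem queryMean_singleton_le (hS : S.IsPrivate T) (hT : 1 ≤ T) (hTN : T ≤ N) (j : Fin N)
    (θ : Fin M) :
    S.queryMean θ (fun x => S.residual x {j} ∅) ≤ entropy S.law (S.answer j) := by
  have hM : (M : ℝ) ≠ 0 := by exact_mod_cast (Fin.pos θ).ne'
  have h := S.sum_entropy_recordLaw_le (Fin.pos θ) (S.answer j)
  refine le_trans (le_of_eq ?_) h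
  have h1 : ∀ θ', ∑ s, S.prob s * entropy (recordLaw F M L) (fun w => S.answer j (θ', s, w)) =
      S.queryMean θ (fun x => S.residual x {j} ∅) := by
    intro θ'
    rw [queryMean_singleton_eq hS hT hTN j θ θ']
    simp only [residual_singleton]
    rfl
  simp only [h1, sum_const, card_univ, Fintype.card_fin, nsmul_eq_mul]
  rw [← mul_assoc, mul_inv_cancel₀ hM, one_mul]

theorem meanResidual_zero_le_sum (hM : 0 < M) :
    S.meanResidual 0 hM ≤ ∑ j, S.queryMean ⟨0, hM⟩ (fun x => S.residual x {j} ∅) := by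
  rw [← queryMean_sum, meanResidual, initial_zero]
  exact S.queryMean_mono _ fun x => S.residual_le_sum x ∅ univ

/-- The capacity bound for `T`-PIR schemes. -/
theorem mul_sum_pow_le_sum_entropy (hS : S.IsTPIR T) (hT : 1 ≤ T) (hTN : T ≤ N) (hM : 0 < M) :
    L * Real.log (Fintype.card F) * ∑ i ∈ range M, ((T : ℝ) / N) ^ i ≤
      ∑ j, entropy S.law (S.answer j) :=
  (mul_sum_pow_le_meanResidual hS hT hTN hM).trans <| (meanResidual_zero_le_sum hM).trans <|
    sum_le_sum fun j _ => queryMean_singleton_le hS.2 hT hTN j _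

/-! ### Schemes that attain the capacity bound. -/

section Equality

variable (hS : S.IsTPIR T) (hT : 1 ≤ T) (hTN : T < N)
  (heq : L * Real.log (Fintype.card F) * ∑ i ∈ range M, ((T : ℝ) / N) ^ i =
    ∑ j, entropy S.law (S.answer j))

include hS hT hTN heq

theorem meanResidual_eq {k : ℕ} (hk : k < M) :
    S.meanResidual k hk =
      L * Real.log (Fintype.card F) * ∑ i ∈ range (M - k), ((T : ℝ) / N) ^ i := by
  have hT' : (0 : ℝ) < T := by exact_mod_cast hT
  have hN : (0 : ℝ) < N := by exact_mod_cast (by omega : 0 < N)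
  refine le_antisymm ?_ (mul_sum_pow_le_meanResidual hS hT hTN.le hk)
  induction k with
  | zero =>
    rw [Nat.sub_zero, heq]
    exact (meanResidual_zero_le_sum hk).trans <|
      sum_le_sum fun j _ => queryMean_singleton_le hS.2 hT hTN.le j _
  | succ k ih =>
    have h1 := ih (by omega)
    have h2 := mul_meanResidual_succ_le hS hT hTN.le hk
    rw [show M - k = (M - (k + 1)) + 1 by omega, sum_range_succ'] at h1
    simp only [pow_succ, ← sum_mul, pow_zero] at h1
    have h3 : (T : ℝ) / N * S.meanResidual (k + 1) hk ≤ (T : ℝ) / N *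
        (L * Real.log (Fintype.card F) * ∑ i ∈ range (M - (k + 1)), ((T : ℝ) / N) ^ i) := by
      rw [div_mul_eq_mul_div, div_le_iff₀ hN]
      refine h2.trans ?_
      rw [mul_comm]
      refine mul_le_mul_of_nonneg_right ?_ hN.le
      linarith
    exact le_of_mul_le_mul_left h3 (by positivity)

/-- Attaining the bound makes each answer's conditional entropy constant, equal to the unconditional
one, and makes the answers independent for every query of positive probability. -/
theorem residual_zero_eq (hM : 0 < M) {s : S.Rand} (hs : 0 < S.prob s) :
    S.residual (S.que ⟨0, hM⟩ s) univ ∅ = ∑ j, entropy S.law (S.answer j) := by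
  have h0 := meanResidual_eq hS hT hTN heq hM
  rw [Nat.sub_zero, heq] at h0
  have hle := fun j (_ : j ∈ univ) => queryMean_singleton_le hS.2 hT hTN.le j (⟨0, hM⟩ : Fin M)
  have hsum : ∑ j, S.queryMean ⟨0, hM⟩ (fun x => S.residual x {j} ∅) =
      ∑ j, entropy S.law (S.answer j) :=
    le_antisymm (sum_le_sum hle) (h0 ▸ meanResidual_zero_le_sum hM)
  have hM' : (M : ℝ) ≠ 0 := by exact_mod_cast hM.ne'
  have hj : ∀ j, S.residual (S.que ⟨0, hM⟩ s) {j} ∅ = entropy S.law (S.answer j) := by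
    intro j
    have h1 := (Finset.sum_eq_sum_iff_of_le hle).1 hsum j (mem_univ j)
    rw [residual_singleton]
    refine S.entropy_recordLaw_eq hM (S.answer j) ?_ ⟨0, hM⟩ hs
    rw [← h1]
    have h2 : ∀ θ, ∑ s, S.prob s * entropy (recordLaw F M L) (fun w => S.answer j (θ, s, w)) =
        S.queryMean ⟨0, hM⟩ (fun x => S.residual x {j} ∅) := by
      intro θ
      rw [queryMean_singleton_eq hS.2 hT hTN.le j _ θ]
      simp only [residual_singleton]
      rfl
    simp only [h2, sum_const, card_univ, Fintype.card_fin, nsmul_eq_mul]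
    rw [← mul_assoc, mul_inv_cancel₀ hM', one_mul]
  rw [← Finset.sum_congr rfl fun j _ => hj j]
  refine S.eq_of_queryMean_eq ⟨0, hM⟩ (φ := fun x => S.residual x univ ∅)
    (ψ := fun x => ∑ j, S.residual x {j} ∅) (fun x => S.residual_le_sum x ∅ univ) ?_ hs
  rw [queryMean_sum, hsum, ← h0, meanResidual, initial_zero]

/-- Equality forces any T answers to have the full residual when record k is desired. Privacy
transfers this constant value to the queries for record k + 1, where Han's inequality is also an
equality, so its equality case applies. -/
theorem residual_succ_eq {k : ℕ} (hk : k + 1 < M) {c : ℝ}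
    (hc : ∀ s, 0 < S.prob s → S.residual (S.que ⟨k, by omega⟩ s) univ (initial M k) = c) :
    ∀ s, 0 < S.prob s → ∃ Γ₁ Γ₂,
      c - L * Real.log (Fintype.card F) =
        T * (S.residual (S.que ⟨k + 1, hk⟩ s) Γ₁ (initial M (k + 1)) -
          S.residual (S.que ⟨k + 1, hk⟩ s) Γ₂ (initial M (k + 1))) ∧
      S.residual (S.que ⟨k + 1, hk⟩ s) univ (initial M (k + 1)) =
        N * (S.residual (S.que ⟨k + 1, hk⟩ s) Γ₁ (initial M (k + 1)) -
          S.residual (S.que ⟨k + 1, hk⟩ s) Γ₂ (initial M (k + 1))) := by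
  classical
  have hkM : k < M := by omega
  have hN : (0 : ℝ) < N := by exact_mod_cast (by omega : 0 < N)
  set Λ := initial M (k + 1) with hΛ
  set P : Finset (Finset (Fin N)) := powersetCard T univ with hPdef
  set ℓ := L * Real.log (Fintype.card F)
  have hP : (0 : ℝ) < #P := card_powersetCard_pos hTN.le
  -- equality holds in all steps of the bound
  have hstep : T * S.meanResidual (k + 1) hk = N * (S.meanResidual k hkM - ℓ) := by
    rw [meanResidual_eq hS hT hTN heq, meanResidual_eq hS hT hTN heq,
      show M - k = (M - (k + 1)) + 1 by omega, sum_range_succ']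
    simp only [pow_succ, ← sum_mul, pow_zero]
    field_simp
    ring
  have h1 : S.queryMean ⟨k + 1, hk⟩ (fun x => T * #P * S.residual x univ Λ) ≤
      S.queryMean ⟨k + 1, hk⟩ (fun x => N * ∑ Γ ∈ P, S.residual x Γ Λ) :=
    S.queryMean_mono _ fun x => card_mul_residual_le_sum hT hTN.le x _
  have h2 := S.queryMean_mono (⟨k, hkM⟩ : Fin M) fun x => sum_residual_le (T := T) x Λ
  have h2' : S.queryMean ⟨k + 1, hk⟩ (fun x => N * ∑ Γ ∈ P, S.residual x Γ Λ) =
      N * S.queryMean ⟨k, hkM⟩ (fun x => ∑ Γ ∈ P, S.residual x Γ Λ) := by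
    rw [queryMean_const_mul, queryMean_sum, queryMean_sum, Finset.sum_congr rfl fun Γ hΓ =>
      queryMean_residual_eq hS.2 (mem_powersetCard_univ.1 hΓ) _ _ ⟨k, hkM⟩]
  have h3 : S.queryMean ⟨k + 1, hk⟩ (fun x => T * #P * S.residual x univ Λ) =
      N * S.queryMean ⟨k, hkM⟩ (fun x => #P * S.residual x univ Λ) := by
    rw [meanResidual_eq_add hS.1 hkM, add_sub_cancel_left, meanResidual] at hstep
    rw [queryMean_const_mul, queryMean_const_mul]
    linear_combination (#P : ℝ) * hstep
  have h4 : S.queryMean ⟨k, hkM⟩ (fun x => ∑ Γ ∈ P, S.residual x Γ Λ) =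
      S.queryMean ⟨k, hkM⟩ (fun x => #P * S.residual x univ Λ) := by
    refine le_antisymm h2 (le_of_mul_le_mul_left ?_ hN)
    rw [← h3, ← h2']
    exact h1
  have h5 : S.queryMean ⟨k + 1, hk⟩ (fun x => T * #P * S.residual x univ Λ) =
      S.queryMean ⟨k + 1, hk⟩ (fun x => N * ∑ Γ ∈ P, S.residual x Γ Λ) := by
    rw [h2', h4, h3]
  -- hence the answers of any `T` servers determine the other ones
  have h6 : ∀ Γ : Finset (Fin N), #Γ = T → ∀ s, 0 < S.prob s →
      S.residual (S.que ⟨k, hkM⟩ s) Γ Λ = c - ℓ := by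
    intro Γ hΓ s hs
    have h7 := S.eq_of_queryMean_eq ⟨k, hkM⟩ (fun x => sum_residual_le (T := T) x Λ) h4 hs
    rw [← nsmul_eq_mul, ← sum_const] at h7
    rw [(Finset.sum_eq_sum_iff_of_le fun Γ _ => S.residual_mono _ (subset_univ Γ) Λ).1 h7 Γ
      (mem_powersetCard_univ.2 hΓ)]
    have h8 := S.residual_univ_eq_add hS.1 (by omega) hs (notMem_initial hkM)
    rw [hc s hs, insert_initial] at h8
    linarith
  have h9 : ∀ Γ : Finset (Fin N), #Γ = T → ∀ s, 0 < S.prob s →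
      S.residual (S.que ⟨k + 1, hk⟩ s) Γ Λ = c - ℓ := by
    intro Γ hΓ s hs
    -- An almost sure property of the queries to Γ is transferred by privacy as the vanishing mean
    -- of the indicator of its failure.
    let φ : (∀ j, S.Query j) → ℝ := fun x => if S.residual x Γ Λ = c - ℓ then 0 else 1
    have e1 : S.queryMean ⟨k, hkM⟩ φ = S.queryMean ⟨k, hkM⟩ fun _ => 0 :=
      S.queryMean_congr _ fun s hs => if_pos (h6 Γ hΓ s hs)
    rw [S.queryMean_eq_of_isPrivate (by omega) hS.2 hΓ (φ := φ)
      (fun x x' hx => by simp only [φ, S.residual_congr hx]) _ ⟨k + 1, hk⟩, queryMean_const,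
      ← S.queryMean_const ⟨k + 1, hk⟩ 0] at e1
    have e2 := S.eq_of_queryMean_eq ⟨k + 1, hk⟩ (φ := fun _ => 0) (ψ := φ)
      (fun x => by simp only [φ]; split_ifs <;> norm_num) e1.symm hs
    by_contra hne
    simp [φ, hne] at e2
  intro s hs
  refine eq_of_card_mul_eq_sum (f := fun Γ => S.residual (S.que ⟨k + 1, hk⟩ s) Γ Λ) hT hTN
    (S.residual_empty _ Λ) (S.residual_submodular _ Λ) ?_
    fun Γ hΓ => h9 Γ hΓ s hs
  exact S.eq_of_queryMean_eq ⟨k + 1, hk⟩ (φ := fun x => T * #P * S.residual x univ Λ)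
    (ψ := fun x => N * ∑ Γ ∈ P, S.residual x Γ Λ) (fun x => card_mul_residual_le_sum hT
      hTN.le x _) h5 hs

end Equality

end PIRScheme

/-! ### Divisibility of the sub-packetization. -/

theorem pow_dvd_of_recurrence {n t : ℤ} (hnt : IsCoprime t n) {m : ℕ} {z : ℕ → ℤ}
    (h : ∀ k < m, n * z k = n * z m + t * z (k + 1)) : n ^ m ∣ z m := by
  have key : ∀ i ≤ m, ∃ S : ℤ, IsCoprime S n ∧ n ^ i * z (m - i) = S * z m := by
    intro i
    induction i with
    | zero => exact fun _ => ⟨1, isCoprime_one_left, by simp⟩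
    | succ i ih =>
      intro hi
      obtain ⟨S, hS, hz⟩ := ih (by omega)
      -- Descending from m, n ^ i * z (m - i) is a multiple of z m whose multiplier is congruent to
      -- t ^ i modulo n, hence coprime to n. At i = m the power n ^ m must divide z m.
      refine ⟨t * S + n ^ i * n, (hnt.mul_left hS).add_mul_right_left _, ?_⟩
      have h1 := h (m - (i + 1)) (by omega)
      rw [show m - (i + 1) + 1 = m - i by omega] at h1
      rw [pow_succ, mul_assoc, h1]
      linear_combination t * hz
  obtain ⟨S, hS, hz⟩ := key m le_rfl
  exact (hS.symm.pow_left).dvd_of_dvd_mul_left (hz ▸ Dvd.intro _ rfl)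

namespace PIRScheme

variable {F : Type} [Field F] [Fintype F] {N M L : ℕ} {S : PIRScheme F N M L} {T : ℕ}

/-- The sub-packetization of a linear scheme that attains the capacity bound. -/
theorem mul_pow_dvd_of_isLinear (hS : S.IsTPIR T) (hlin : S.IsLinear) {d n t : ℕ} (hd : 0 < d)
    (ht : 0 < t) (htn : t < n) (hcop : t.Coprime n) (hN : N = d * n) (hT : T = d * t) (hM : 2 ≤ M)
    (heq : L * Real.log (Fintype.card F) * ∑ i ∈ range M, ((T : ℝ) / N) ^ i =
      ∑ j, entropy S.law (S.answer j)) :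
    N * n ^ (M - 2) ∣ L := by
  have hT1 : 1 ≤ T := hT ▸ Nat.mul_pos hd ht
  have hTN : T < N := by rw [hT, hN]; exact Nat.mul_lt_mul_of_pos_left htn hd
  have hlq : 0 < Real.log (Fintype.card F) :=
    Real.log_pos (by exact_mod_cast Fintype.one_lt_card)
  have hT0 : (0 : ℝ) < T := by exact_mod_cast hT1
  have step : ∀ (k : ℕ) (hk : k + 1 < M) (c : ℝ),
      (∀ s, 0 < S.prob s → S.residual (S.que ⟨k, by omega⟩ s) univ (initial M k) = c) →
      ∃ z : ℤ, c - L * Real.log (Fintype.card F) = T * (z * Real.log (Fintype.card F)) ∧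
        ∀ s, 0 < S.prob s → S.residual (S.que ⟨k + 1, hk⟩ s) univ (initial M (k + 1)) =
          N * (z * Real.log (Fintype.card F)) := by
    intro k hk c hc
    have hint : ∀ s, 0 < S.prob s → ∃ z : ℤ,
        c - L * Real.log (Fintype.card F) = T * (z * Real.log (Fintype.card F)) ∧
        S.residual (S.que ⟨k + 1, hk⟩ s) univ (initial M (k + 1)) =
          N * (z * Real.log (Fintype.card F)) := by
      intro s hs
      obtain ⟨Γ₁, Γ₂, h1, h2⟩ := residual_succ_eq hS hT1 hTN heq hk hc s hs
      obtain ⟨z₁, hz₁⟩ := S.exists_residual_eq_of_isLinear hlin (S.que ⟨k + 1, hk⟩ s) Γ₁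
        (initial M (k + 1))
      obtain ⟨z₂, hz₂⟩ := S.exists_residual_eq_of_isLinear hlin (S.que ⟨k + 1, hk⟩ s) Γ₂
        (initial M (k + 1))
      rw [hz₁, hz₂, ← sub_mul] at h1 h2
      exact ⟨z₁ - z₂, by push_cast; exact h1, by push_cast; exact h2⟩
    -- The first identity determines z from c, so z does not depend on s and the next residual is
    -- again constant.
    obtain ⟨s₀, hs₀⟩ := S.exists_prob_pos
    obtain ⟨z, hz, -⟩ := hint s₀ hs₀
    refine ⟨z, hz, fun s hs => ?_⟩
    obtain ⟨z', hz', hr⟩ := hint s hs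
    rw [hr, mul_left_cancel₀ hT0.ne' (hz'.symm.trans hz)]
  have hconst : ∀ k, ∃ c : ℝ, ∀ (hk : k < M) (s), 0 < S.prob s →
      S.residual (S.que ⟨k, hk⟩ s) univ (initial M k) = c := by
    intro k
    induction k with
    | zero =>
      exact ⟨_, fun hk s hs => by
        rw [initial_zero, residual_zero_eq hS hT1 hTN heq (by omega) hs]⟩
    | succ k ih =>
      obtain ⟨c, hc⟩ := ih
      by_cases hk : k + 1 < M
      · obtain ⟨z, -, hz⟩ := step k hk c (hc (by omega))
        exact ⟨_, fun _ => hz⟩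
      · exact ⟨0, fun h => absurd h hk⟩
  choose c hc using hconst
  have hz : ∀ k, ∃ z : ℤ, k + 1 < M →
      c k - L * Real.log (Fintype.card F) = T * (z * Real.log (Fintype.card F)) ∧
        c (k + 1) = N * (z * Real.log (Fintype.card F)) := by
    intro k
    by_cases hk : k + 1 < M
    · obtain ⟨z, h1, h2⟩ := step k hk (c k) (hc k (by omega))
      obtain ⟨s₀, hs₀⟩ := S.exists_prob_pos
      exact ⟨z, fun _ => ⟨h1, by rw [← h2 s₀ hs₀, hc (k + 1) hk s₀ hs₀]⟩⟩
    · exact ⟨0, fun h => absurd h hk⟩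
  choose z hz using hz
  -- With M - 1 records known, what remains is exactly the last record.
  have hlast : (N : ℤ) * z (M - 2) = L := by
    have h1 := (hz (M - 2) (by omega)).2
    obtain ⟨s₀, hs₀⟩ := S.exists_prob_pos
    have h2 := S.residual_univ_eq_add hS.1 (by omega) hs₀
      (notMem_initial (show M - 2 + 1 < M by omega))
    rw [insert_initial, show M - 2 + 1 + 1 = M by omega, initial_self, residual_univ_univ,
      hc _ _ s₀ hs₀, h1, add_zero, ← mul_assoc] at h2
    have h3 := mul_right_cancel₀ hlq.ne' h2
    exact_mod_cast h3
  have hrec : ∀ k < M - 2, (n : ℤ) * z k = n * z (M - 2) + t * z (k + 1) := by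
    intro k hk
    have h1 := (hz k (by omega)).2
    have h2 := (hz (k + 1) (by omega)).1
    rw [h1, ← mul_assoc, ← sub_mul, ← mul_assoc] at h2
    have h3 := mul_right_cancel₀ hlq.ne' h2
    have h4 : (N : ℤ) * z k - L = T * z (k + 1) := by exact_mod_cast h3
    rw [← hlast, hN, hT] at h4
    push_cast at h4
    have hd' : (d : ℤ) ≠ 0 := by exact_mod_cast hd.ne'
    refine mul_left_cancel₀ hd' ?_
    linear_combination h4
  have hdvd := pow_dvd_of_recurrence (Nat.isCoprime_iff_coprime.2 hcop) hrec
  have : ((N * n ^ (M - 2) : ℕ) : ℤ) ∣ (L : ℤ) := by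
    rw [← hlast]
    push_cast
    exact mul_dvd_mul_left _ hdvd
  exact_mod_cast this

end PIRScheme

/-! ### Hiding a fixed pattern by random changes of basis. -/

/-- A linear scheme in which the vectors of a fixed pattern are hidden by random changes of bases
of the spaces of functionals on the records. -/
theorem exists_scheme_of_pattern {F : Type} [Field F] [Fintype F] {N M L T : ℕ} (hM : 0 < M)
    (P : Fin N → Type) [∀ j, Fintype (P j)] (v : Fin M → Fin M → ∀ j, P j → (Fin L → F))
    (hpriv : ∀ Γ : Finset (Fin N), #Γ = T → ∀ θ θ' m, ∃ g : (Fin L → F) ≃ₗ[F] (Fin L → F),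
      ∀ j ∈ Γ, ∀ p, g (v θ m j p) = v θ' m j p)
    (hdec : ∀ θ (ψ : Fin M → (Fin L → F) →ₗ[F] F),
      (∀ j p, ∑ m, ψ m (v θ m j p) = 0) → ψ θ = 0) :
    ∃ S : PIRScheme F N M L, S.IsLinear ∧ S.IsTPIR T ∧
      ∀ j, entropy S.law (S.answer j) ≤ Fintype.card (P j) * Real.log (Fintype.card F) := by
  classical
  have hfin : Finite ((Fin L → F) ≃ₗ[F] (Fin L → F)) := DFunLike.finite _
  let iR : Fintype (Fin M → ((Fin L → F) ≃ₗ[F] (Fin L → F))) := Fintype.ofFinite _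
  have hcR : (Fintype.card (Fin M → ((Fin L → F) ≃ₗ[F] (Fin L → F))) : ℝ) ≠ 0 := by
    exact_mod_cast Fintype.card_ne_zero
  let S : PIRScheme F N M L :=
    { Rand := Fin M → ((Fin L → F) ≃ₗ[F] (Fin L → F))
      prob := fun _ => (Fintype.card (Fin M → ((Fin L → F) ≃ₗ[F] (Fin L → F))) : ℝ)⁻¹
      prob_nonneg := fun _ => by positivity
      prob_sum := by
        rw [sum_const, card_univ, nsmul_eq_mul, mul_inv_cancel₀ hcR]
      Query := fun j => Fin M → P j → Fin L → F
      Answer := fun j => P j → F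
      que := fun θ s j m p => s m (v θ m j p)
      ans := fun j x w p => ∑ m, x m p ⬝ᵥ w m }
  refine ⟨S, ?_, ⟨?_, ?_⟩, fun j => ?_⟩
  · refine ⟨fun j => Fintype.card (P j),
      fun j => Equiv.arrowCongr (Fintype.equivFin (P j)) (Equiv.refl F), fun j x => ⟨?_, ?_⟩⟩
    · intro w w'
      funext i
      simp [S, Equiv.arrowCongr, dotProduct_add, sum_add_distrib]
    · intro a w
      funext i
      simp [S, Equiv.arrowCongr, dotProduct_smul, mul_sum]
  · refine S.isCorrect_of_decodable fun θ s w w' h => ?_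
    have h0 := hdec θ (fun m => ((dotProductBilin F F : (Fin L → F) →ₗ[F] (Fin L → F) →ₗ[F] F)
      (w m - w' m)).comp (s m).toLinearMap) fun j p => by
        have h1 : ∑ m, s m (v θ m j p) ⬝ᵥ w m = ∑ m, s m (v θ m j p) ⬝ᵥ w' m := congrFun (h j) p
        rw [← sub_eq_zero, ← sum_sub_distrib] at h1
        refine Eq.trans (sum_congr rfl fun m _ => ?_) h1
        change (w m - w' m) ⬝ᵥ s m (v θ m j p) = _
        rw [dotProduct_comm, dotProduct_sub]
    rw [← sub_eq_zero]
    refine dotProduct_eq_zero _ fun u => ?_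
    have := LinearMap.congr_fun h0 ((s θ).symm u)
    simpa using this
  · refine S.isPrivate_of_equiv hM fun Γ hΓ θ θ' => ?_
    choose g hg using hpriv Γ hΓ θ' θ
    -- Precomposing the random automorphism of record m with `g m` permutes the uniform resources
    -- and turns the pattern for θ' into the one for θ on Γ.
    refine ⟨Equiv.piCongrRight fun m => ⟨fun e => (g m).trans e, fun e => (g m).symm.trans e,
      fun e => by ext; simp, fun e => by ext; simp⟩, fun _ => rfl, fun s j hj => ?_⟩
    funext m p
    change s m (g m (v θ' m j p)) = s m (v θ m j p)
    rw [hg m j hj p]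
  · refine (entropy_le_log_card S.law_nonneg (S.sum_law hM) (S.answer j)).trans_eq ?_
    have : Fintype.card (S.Answer j) = Fintype.card F ^ Fintype.card (P j) := by
      exact Fintype.card_fun
    rw [this, Nat.cast_pow, Real.log_pow]

/-! ### The pattern of sums: independence on T servers and decodability. -/

section Pattern

variable {N M : ℕ} (α : Fin N → ℕ → ℕ)

/-- The sums returned by server `j`: for each set of `k` records, there are `α j k` of them. -/
abbrev Position (M : ℕ) (j : Fin N) : Type := Σ Λ : Finset (Fin M), Fin (α j #Λ)

variable {α}

/-- The position, among the sums of undesired records, of the undesired part of a sum. -/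
def undesiredPosition (θ : Fin M) (j : Fin N) (p : Position α M j) :
    Σ Λ : Finset (Fin M), Fin (α j #Λ) ⊕ Fin (α j (#Λ + 1)) :=
  if h : θ ∈ p.1 then
    ⟨p.1.erase θ, Sum.inr (Fin.cast (by rw [card_erase_add_one h]) p.2)⟩
  else ⟨p.1, Sum.inl p.2⟩

theorem undesiredPosition_fst (θ : Fin M) (j : Fin N) (p : Position α M j) :
    (undesiredPosition θ j p).1 = p.1.erase θ := by
  unfold undesiredPosition
  split_ifs with h
  · rfl
  · exact (erase_eq_of_notMem h).symm

theorem notMem_undesiredPosition (θ : Fin M) (j : Fin N) (p : Position α M j) :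
    θ ∉ (undesiredPosition θ j p).1 := by
  rw [undesiredPosition_fst]; exact notMem_erase _ _

theorem mem_undesiredPosition {θ m : Fin M} {j : Fin N} {p : Position α M j} :
    m ∈ (undesiredPosition θ j p).1 ↔ m ≠ θ ∧ m ∈ p.1 := by
  rw [undesiredPosition_fst, mem_erase]

theorem undesiredPosition_of_notMem {θ : Fin M} (j : Fin N) {Λ : Finset (Fin M)} (h : θ ∉ Λ)
    (i : Fin (α j #Λ)) : undesiredPosition θ j ⟨Λ, i⟩ = ⟨Λ, Sum.inl i⟩ := dif_neg h

theorem undesiredPosition_injective (θ : Fin M) (j : Fin N) :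
    Function.Injective (undesiredPosition (α := α) θ j) := by
  let back : (Σ Λ : Finset (Fin M), Fin (α j #Λ) ⊕ Fin (α j (#Λ + 1))) → Finset (Fin M) × ℕ
    | ⟨Λ, Sum.inl i⟩ => (Λ, i)
    | ⟨Λ, Sum.inr i⟩ => (insert θ Λ, i)
  have hback : ∀ p : Position α M j, back (undesiredPosition θ j p) = (p.1, (p.2 : ℕ)) := by
    intro p
    unfold undesiredPosition
    split_ifs with h
    · simp [back, insert_erase h]
    · simp [back]
  rintro ⟨Λ, i⟩ ⟨Λ', i'⟩ h
  have h1 := congrArg back h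
  rw [hback, hback] at h1
  simp only [Prod.mk.injEq] at h1
  obtain ⟨rfl, h2⟩ := h1
  rw [Fin.ext h2]

theorem card_notMem_lt {θ : Fin M} {Λ : Finset (Fin M)} (h : θ ∉ Λ) : #Λ < M := by
  simpa using Finset.card_lt_univ_of_notMem h

variable {F : Type} [Field F] {L : ℕ} {c : ℕ → ℕ}

/-- The functional on record `m` used in a sum, when record `θ` is desired: the functionals `b` on
the desired record are independent, those on an undesired one are given by the vectors `e` of a
code that does not depend on the record, embedded by `J`. -/
noncomputable def patternVector
    (e : ∀ k (j : Fin N), Fin (α j k) ⊕ Fin (α j (k + 1)) → (Fin (c k) → F))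
    (b : Fin M → (Σ j, Position α M j) → (Fin L → F))
    (J : ∀ θ m : Fin M,
      (∀ Λ : {Λ : Finset (Fin M) // θ ∉ Λ ∧ m ∈ Λ}, Fin (c #Λ.1) → F) →ₗ[F] (Fin L → F))
    (θ m : Fin M) (j : Fin N) (p : Position α M j) : Fin L → F :=
  if hm : m ∈ p.1 then
    if hθ : m = θ then b θ ⟨j, p⟩
    else J θ m (Pi.single ⟨(undesiredPosition θ j p).1, notMem_undesiredPosition θ j p,
      mem_undesiredPosition.2 ⟨hθ, hm⟩⟩ (e _ j (undesiredPosition θ j p).2))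
  else 0

variable {e : ∀ k (j : Fin N), Fin (α j k) ⊕ Fin (α j (k + 1)) → (Fin (c k) → F)}
  {b : Fin M → (Σ j, Position α M j) → (Fin L → F)}
  {J : ∀ θ m : Fin M,
    (∀ Λ : {Λ : Finset (Fin M) // θ ∉ Λ ∧ m ∈ Λ}, Fin (c #Λ.1) → F) →ₗ[F] (Fin L → F)}

/-- For m = θ the vectors are part of an independent family. For m ≠ θ, different sets Λ use
different summands, which `J` embeds injectively, and within one summand the blocks of the servers
in Γ are independent by the code. The index type does not involve θ, so the families for two desired
records can be matched. -/
theorem linearIndependent_patternVector {Γ : Finset (Fin N)}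
    (he : ∀ k, 1 ≤ k → k < M → LinearIndependent F
      (fun p : Σ j : Γ, (Fin (α j k) ⊕ Fin (α j (k + 1))) => e k p.1 p.2))
    (hb : ∀ θ, LinearIndependent F
      (fun q : {q : Σ j, Position α M j // θ ∈ q.2.1} => b θ q.1))
    (hJ : ∀ θ m, m ≠ θ → Function.Injective (J θ m)) (θ m : Fin M) :
    LinearIndependent F (fun q : {q : Σ j : Γ, Position α M j // m ∈ q.2.1} =>
      patternVector e b J θ m q.1.1 q.1.2) := by
  by_cases hmθ : m = θ
  · subst hmθ
    have hv : (fun q : {q : Σ j : Γ, Position α M j // m ∈ q.2.1} =>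
        patternVector e b J m m q.1.1 q.1.2) =
        (fun q : {q : Σ j, Position α M j // m ∈ q.2.1} => b m q.1) ∘
          fun q => ⟨⟨q.1.1, q.1.2⟩, q.2⟩ := by
      funext q
      simp [patternVector, q.2]
    rw [hv]
    refine (hb m).comp _ ?_
    rintro ⟨⟨⟨j, hj⟩, p⟩, hp⟩ ⟨⟨⟨j', hj'⟩, p'⟩, hp'⟩ h
    obtain ⟨rfl, h2⟩ := Sigma.mk.inj (Subtype.mk.inj h)
    obtain rfl := eq_of_heq h2
    rfl
  · have h1 := Pi.linearIndependent_single (R := F)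
      (fun (Λ : {Λ : Finset (Fin M) // θ ∉ Λ ∧ m ∈ Λ})
        (x : Σ j : Γ, (Fin (α j #Λ.1) ⊕ Fin (α j (#Λ.1 + 1)))) => e #Λ.1 x.1 x.2)
      fun Λ => he _ (card_pos.2 ⟨m, Λ.2.2⟩) (card_notMem_lt Λ.2.1)
    have h2 := h1.map' (J θ m) (LinearMap.ker_eq_bot.2 (hJ θ m hmθ))
    let f : {q : Σ j : Γ, Position α M j // m ∈ q.2.1} →
        Σ Λ : {Λ : Finset (Fin M) // θ ∉ Λ ∧ m ∈ Λ},
          Σ j : Γ, (Fin (α j #Λ.1) ⊕ Fin (α j (#Λ.1 + 1))) := fun q =>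
      ⟨⟨(undesiredPosition θ q.1.1.1 q.1.2).1, notMem_undesiredPosition θ q.1.1.1 q.1.2,
        mem_undesiredPosition.2 ⟨hmθ, q.2⟩⟩, ⟨q.1.1, (undesiredPosition θ q.1.1.1 q.1.2).2⟩⟩
    have hf : Function.Injective f := by
      rintro ⟨⟨j, p⟩, hp⟩ ⟨⟨j', p'⟩, hp'⟩ h
      have h3 := congrArg (fun q : Σ Λ : {Λ : Finset (Fin M) // θ ∉ Λ ∧ m ∈ Λ},
          Σ j : Γ, (Fin (α j #Λ.1) ⊕ Fin (α j (#Λ.1 + 1))) =>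
        (⟨q.2.1, ⟨q.1.1, q.2.2⟩⟩ : Σ j : Γ, Σ Λ : Finset (Fin M),
          (Fin (α j #Λ) ⊕ Fin (α j (#Λ + 1))))) h
      obtain ⟨rfl, h4⟩ := Sigma.mk.inj h3
      obtain rfl := undesiredPosition_injective θ _ (eq_of_heq h4)
      rfl
    have hv : (fun q : {q : Σ j : Γ, Position α M j // m ∈ q.2.1} =>
        patternVector e b J θ m q.1.1 q.1.2) = (J θ m ∘ fun q : Σ Λ :
          {Λ : Finset (Fin M) // θ ∉ Λ ∧ m ∈ Λ},
          Σ j : Γ, (Fin (α j #Λ.1) ⊕ Fin (α j (#Λ.1 + 1))) =>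
            Pi.single q.1 (e #q.1.1 q.2.1 q.2.2)) ∘ f := by
      funext q
      simp [patternVector, q.2, hmθ, f]
    rw [hv]
    exact h2.comp f hf

/-- All undesired records in Λ use the same code, so together they contribute one functional χ Λ on
it. The bare sums make χ Λ vanish on an information set, hence everywhere; the sums containing θ are
then free of interference, and their vectors span. -/
theorem eq_zero_of_patternVector
    (he : ∀ k, 1 ≤ k → k < M →
      Submodule.span F (Set.range fun p : Σ j, Fin (α j k) => e k p.1 (Sum.inl p.2)) = ⊤)
    (hb : ∀ θ, Submodule.span F
      (Set.range fun q : {q : Σ j, Position α M j // θ ∈ q.2.1} => b θ q.1) = ⊤)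
    (θ : Fin M) (ψ : Fin M → (Fin L → F) →ₗ[F] F)
    (h : ∀ j p, ∑ m, ψ m (patternVector e b J θ m j p) = 0) : ψ θ = 0 := by
  classical
  -- the functional that the undesired records in `Λ` define on the code
  let χ : ∀ Λ : {Λ : Finset (Fin M) // θ ∉ Λ}, (Fin (c #Λ.1) → F) →ₗ[F] F := fun Λ =>
    ∑ m, if hm : m ∈ Λ.1 then
      (ψ m ∘ₗ J θ m) ∘ₗ LinearMap.single F
        (fun Λ : {Λ : Finset (Fin M) // θ ∉ Λ ∧ m ∈ Λ} => Fin (c #Λ.1) → F) ⟨Λ.1, Λ.2, hm⟩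
      else 0
  have hsum : ∀ j p, ∑ m, ψ m (patternVector e b J θ m j p) =
      (if θ ∈ p.1 then ψ θ (b θ ⟨j, p⟩) else 0) +
        χ ⟨(undesiredPosition θ j p).1, notMem_undesiredPosition θ j p⟩
          (e _ j (undesiredPosition θ j p).2) := by
    intro j p
    simp only [χ, LinearMap.sum_apply]
    rw [← Fintype.sum_ite_eq θ (fun m => if m ∈ p.1 then ψ m (b m ⟨j, p⟩) else 0),
      ← sum_add_distrib]
    refine Finset.sum_congr rfl fun m _ => ?_
    by_cases hmθ : m = θ
    · subst hmθ
      by_cases hm : m ∈ p.1 <;> simp [patternVector, hm, notMem_undesiredPosition]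
    · by_cases hm : m ∈ p.1
      · rw [dif_pos (mem_undesiredPosition.2 ⟨hmθ, hm⟩)]
        simp [patternVector, hm, hmθ, Ne.symm hmθ]
      · rw [dif_neg fun h => hm (mem_undesiredPosition.1 h).2]
        simp [patternVector, hm]
  have hχ : ∀ Λ, χ Λ = 0 := by
    rintro ⟨Λ, hΛ⟩
    rcases Λ.eq_empty_or_nonempty with rfl | hne
    · exact Finset.sum_eq_zero fun m _ => dif_neg (notMem_empty m)
    refine LinearMap.ext_on (he #Λ (card_pos.2 hne) (card_notMem_lt hΛ)) ?_
    rintro _ ⟨⟨j, i⟩, rfl⟩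
    have h1 := hsum j ⟨Λ, i⟩
    rw [h, if_neg hΛ, zero_add] at h1
    have h2 : ∀ (q : Σ Λ : Finset (Fin M), Fin (α j #Λ) ⊕ Fin (α j (#Λ + 1)))
        (hq : θ ∉ q.1), q = ⟨Λ, Sum.inl i⟩ →
          χ ⟨q.1, hq⟩ (e _ j q.2) = χ ⟨Λ, hΛ⟩ (e _ j (Sum.inl i)) := by
      rintro _ _ rfl; rfl
    rw [h2 _ _ (undesiredPosition_of_notMem j hΛ i)] at h1
    exact h1.symm
  refine LinearMap.ext_on (hb θ) ?_
  rintro _ ⟨⟨⟨j, p⟩, hp⟩, rfl⟩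
  have h1 := hsum j p
  rw [h, if_pos hp, hχ, LinearMap.zero_apply, add_zero] at h1
  exact h1.symm

end Pattern

/-! ### The binary scheme. -/

section Construction

variable {N M : ℕ} {α : Fin N → ℕ → ℕ}

theorem card_position_of_mem {d n t : ℕ} (htn : t ≤ n)
    (hα : ∀ k, 1 ≤ k → k ≤ M → ∑ j, α j k = d * averageLoad n t M k) (θ : Fin M) :
    Fintype.card {q : Σ j, Position α M j // θ ∈ q.2.1} = d * n ^ (M - 1) := by
  classical
  rw [Fintype.card_subtype, card_filter, Fintype.sum_sigma, ← sum_averageLoad_of_mem θ htn,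
    mul_sum]
  simp only [Fintype.sum_sigma]
  rw [sum_comm]
  refine Finset.sum_congr rfl fun Λ _ => ?_
  by_cases h : θ ∈ Λ
  · have hM : #Λ ≤ M := by simpa using card_le_univ Λ
    simp [h, hα #Λ (card_pos.2 ⟨θ, h⟩) hM]
  · simp [h]

theorem sum_card_position {d n t : ℕ} (htn : t ≤ n) (h0 : ∀ j, α j 0 = 0)
    (hα : ∀ k, 1 ≤ k → k ≤ M → ∑ j, α j k = d * averageLoad n t M k) :
    (n - t) * ∑ j, Fintype.card (Position α M j) + d * t ^ M = d * n ^ M := by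
  classical
  have h1 : ∑ j, Fintype.card (Position α M j) =
      d * ∑ Λ : Finset (Fin M), (if Λ = ∅ then 0 else averageLoad n t M #Λ) := by
    simp only [Fintype.card_sigma, Fintype.card_fin]
    rw [sum_comm, mul_sum]
    refine Finset.sum_congr rfl fun Λ _ => ?_
    rcases Λ.eq_empty_or_nonempty with rfl | hne
    · simp [h0]
    · have hM : #Λ ≤ M := by simpa using card_le_univ Λ
      rw [hα #Λ (card_pos.2 hne) hM, if_neg hne.ne_empty]
  rw [h1, ← sum_averageLoad htn]
  ring

theorem exists_linearEquiv_patternVector {F : Type} [Field F] {L : ℕ} {c : ℕ → ℕ}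
    {e : ∀ k (j : Fin N), Fin (α j k) ⊕ Fin (α j (k + 1)) → (Fin (c k) → F)}
    {b : Fin M → (Σ j, Position α M j) → (Fin L → F)}
    {J : ∀ θ m : Fin M,
      (∀ Λ : {Λ : Finset (Fin M) // θ ∉ Λ ∧ m ∈ Λ}, Fin (c #Λ.1) → F) →ₗ[F] (Fin L → F)}
    {Γ : Finset (Fin N)} (he : ∀ k, 1 ≤ k → k < M → LinearIndependent F
      (fun p : Σ j : Γ, (Fin (α j k) ⊕ Fin (α j (k + 1))) => e k p.1 p.2))
    (hb : ∀ θ, LinearIndependent F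
      (fun q : {q : Σ j, Position α M j // θ ∈ q.2.1} => b θ q.1))
    (hJ : ∀ θ m, m ≠ θ → Function.Injective (J θ m)) (θ θ' m : Fin M) :
    ∃ g : (Fin L → F) ≃ₗ[F] (Fin L → F), ∀ j ∈ Γ, ∀ p,
      g (patternVector e b J θ m j p) = patternVector e b J θ' m j p := by
  obtain ⟨g, hg⟩ := exists_linearEquiv_of_linearIndependent
    (linearIndependent_patternVector he hb hJ θ m) (linearIndependent_patternVector he hb hJ θ' m)
  refine ⟨g, fun j hj p => ?_⟩
  by_cases hm : m ∈ p.1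
  · exact hg ⟨⟨⟨j, hj⟩, p⟩, hm⟩
  · simp [patternVector, hm]

/-- The numbers fit: the sums containing θ are L in number and take a basis of the functionals on
the desired record, the bare bits of a block type number T * β_k, the dimension of the code, and the
total number of sums gives the bound on the answers. -/
theorem exists_linear_scheme {d n t M : ℕ} (ht : 0 < t) (htn : t < n) (hM : 2 ≤ M)
    (hβ : ∀ k, 1 ≤ k → k < M → d * n ≤ 2 ^ blockSize n t M k) :
    ∃ S : PIRScheme (ZMod 2) (d * n) M (d * n * n ^ (M - 2)), S.IsLinear ∧ S.IsTPIR (d * t) ∧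
      ((n : ℝ) - t) * ∑ j, entropy S.law (S.answer j) ≤
        d * ((n : ℝ) ^ M - (t : ℝ) ^ M) * Real.log 2 := by
  classical
  obtain ⟨α, hα0, hαadd, hαsum⟩ := exists_serverLoads (M := M) ht htn d
  set L := d * n * n ^ (M - 2) with hL
  let c : ℕ → ℕ := fun k => d * t * blockSize n t M k
  have hcode : ∀ k, ∃ e : ∀ j, Fin (α j k) ⊕ Fin (α j (k + 1)) → (Fin (c k) → ZMod 2),
      1 ≤ k → k < M → (∀ Γ : Finset (Fin (d * n)), #Γ ≤ d * t → LinearIndependent (ZMod 2)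
        (fun p : Σ j : Γ, (Fin (α j k) ⊕ Fin (α j (k + 1))) => e p.1 p.2)) ∧
      Submodule.span (ZMod 2) (Set.range fun p : Σ j, Fin (α j k) => e p.1 (Sum.inl p.2)) = ⊤ := by
    intro k
    by_cases hk : 1 ≤ k ∧ k < M
    · have hpos : blockSize n t M k ≠ 0 :=
        (Nat.mul_pos (pow_pos (by omega) _) (pow_pos ht _)).ne'
      have hsum : ∑ j, α j k = d * t * blockSize n t M k := by
        rw [hαsum k hk.1 hk.2.le, averageLoad, blockSize, show M - k = M - 1 - k + 1 by omega]
        ring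
      obtain ⟨e, h1, h2⟩ := exists_binary_array_code (Nat.mul_le_mul_left d htn.le) hpos
        (hβ k hk.1 hk.2) (fun j => hαadd j k hk.1 hk.2) hsum
      exact ⟨e, fun _ _ => ⟨h1, h2⟩⟩
    · exact ⟨fun _ _ => 0, fun h h' => absurd ⟨h, h'⟩ hk⟩
  choose e he using hcode
  have hbasis : ∀ θ : Fin M, Nonempty
      (Module.Basis {q : Σ j, Position α M j // θ ∈ q.2.1} (ZMod 2) (Fin L → ZMod 2)) := by
    intro θ
    have hcard : Fintype.card (Fin L) =
        Fintype.card {q : Σ j, Position α M j // θ ∈ q.2.1} := by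
      rw [card_position_of_mem htn.le hαsum θ, Fintype.card_fin, hL,
        show M - 1 = M - 2 + 1 by omega, pow_succ]
      ring
    exact ⟨(Pi.basisFun (ZMod 2) (Fin L)).reindex (Fintype.equivOfCardEq hcard)⟩
  let B := fun θ => (hbasis θ).some
  let b : Fin M → (Σ j, Position α M j) → (Fin L → ZMod 2) := fun θ q =>
    if h : θ ∈ q.2.1 then B θ ⟨q, h⟩ else 0
  have hbB : ∀ θ, (fun q : {q : Σ j, Position α M j // θ ∈ q.2.1} => b θ q.1) = B θ := by
    intro θ
    funext q
    simp [b, q.2]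
  have hJ : ∀ θ m : Fin M, ∃ J : (∀ Λ : {Λ : Finset (Fin M) // θ ∉ Λ ∧ m ∈ Λ},
      Fin (c #Λ.1) → ZMod 2) →ₗ[ZMod 2] (Fin L → ZMod 2), m ≠ θ → Function.Injective J := by
    intro θ m
    by_cases hm : m = θ
    · exact ⟨0, fun h => absurd hm h⟩
    -- The codes that involve record m have total dimension T * n ^ (M - 2), at most L since T ≤ N.
    obtain ⟨J, hJ⟩ := finrank_le_iff_exists_linearMap.1 (show Module.finrank (ZMod 2)
        (∀ Λ : {Λ : Finset (Fin M) // θ ∉ Λ ∧ m ∈ Λ}, Fin (c #Λ.1) → ZMod 2) ≤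
        Module.finrank (ZMod 2) (Fin L → ZMod 2) by
      rw [Module.finrank_pi_fintype, Module.finrank_fin_fun]
      simp only [Module.finrank_fin_fun, c, ← mul_sum]
      rw [sum_blockSize hm htn.le]
      exact Nat.mul_le_mul_right _ (Nat.mul_le_mul_left d htn.le))
    exact ⟨J, fun _ => hJ⟩
  choose J hJ using hJ
  obtain ⟨S, hlin, hS, hent⟩ := exists_scheme_of_pattern (T := d * t) (by omega : 0 < M)
    (Position α M) (patternVector e b J)
    (fun Γ hΓ θ θ' m => exists_linearEquiv_patternVector
      (fun k hk hkM => (he k hk hkM).1 Γ hΓ.le)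
      (fun θ => by rw [hbB]; exact (B θ).linearIndependent) hJ θ θ' m)
    (fun θ ψ h => eq_zero_of_patternVector (fun k hk hkM => (he k hk hkM).2)
      (fun θ => by rw [hbB]; exact (B θ).span_eq) θ ψ h)
  refine ⟨S, hlin, hS, ?_⟩
  have h1 := sum_le_sum fun j (_ : j ∈ univ) => hent j
  rw [← sum_mul, ZMod.card] at h1
  have h2 := sum_card_position htn.le hα0 hαsum
  have htn' : (t : ℝ) < n := by exact_mod_cast htn
  have h3 : ((n : ℝ) - t) * ∑ j, (Fintype.card (Position α M j) : ℝ) =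
      d * ((n : ℝ) ^ M - (t : ℝ) ^ M) := by
    have h4 := congrArg (Nat.cast : ℕ → ℝ) h2
    rw [Nat.cast_add, Nat.cast_mul, Nat.cast_sub htn.le, Nat.cast_sum] at h4
    push_cast at h4
    linarith
  rw [← h3, mul_assoc]
  exact mul_le_mul_of_nonneg_left h1 (by linarith)

end Construction

/-! ### Rates and the conclusion. -/

theorem PIRScheme.rate_le {F : Type} [Field F] [Fintype F] {N M L T : ℕ}
    {S : PIRScheme F N M L} (hS : S.IsTPIR T) (hT : 1 ≤ T) (hTN : T ≤ N) (hM : 0 < M)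
    (hL : 0 < L) : S.rate ≤ (∑ i ∈ range M, ((T : ℝ) / N) ^ i)⁻¹ := by
  have hlq : 0 < Real.log (Fintype.card F) :=
    Real.log_pos (by exact_mod_cast Fintype.one_lt_card)
  have hG : 0 < ∑ i ∈ range M, ((T : ℝ) / N) ^ i :=
    sum_pos' (fun i _ => by positivity) ⟨0, mem_range.2 hM, by simp⟩
  have hL' : (0 : ℝ) < L := by exact_mod_cast hL
  have h := mul_sum_pow_le_sum_entropy hS hT hTN hM
  have hD := (mul_pos (mul_pos hL' hlq) hG).trans_le h
  rw [rate, S.entropy_desired hM, div_le_iff₀ hD, ← div_eq_inv_mul, le_div_iff₀ hG]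
  exact h

theorem PIRScheme.sum_entropy_eq_of_rate_eq {F : Type} [Field F] [Fintype F] {N M L T : ℕ}
    {S : PIRScheme F N M L} (hM : 0 < M)
    (h : S.rate = (∑ i ∈ range M, ((T : ℝ) / N) ^ i)⁻¹) :
    L * Real.log (Fintype.card F) * ∑ i ∈ range M, ((T : ℝ) / N) ^ i =
      ∑ j, entropy S.law (S.answer j) := by
  have hlq : 0 < Real.log (Fintype.card F) :=
    Real.log_pos (by exact_mod_cast Fintype.one_lt_card)
  have hG : 0 < ∑ i ∈ range M, ((T : ℝ) / N) ^ i :=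
    sum_pos' (fun i _ => by positivity) ⟨0, mem_range.2 hM, by simp⟩
  rw [rate, S.entropy_desired hM] at h
  have hD : ∑ j, entropy S.law (S.answer j) ≠ 0 := by
    intro h0
    rw [h0, div_zero] at h
    exact (inv_pos.2 hG).ne h
  rw [div_eq_iff hD, ← div_eq_inv_mul, eq_div_iff hG.ne'] at h
  exact h

theorem mainTheorem2 (N T M n t μ : ℕ) (hT : 1 ≤ T) (hTN : T < N)
    (hn : n = N / Nat.gcd N T) (ht : t = T / Nat.gcd N T)
    (hμ : μ = min t (n - t)) (hμ1 : 1 < μ)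
    (hM : 2 + ⌈Real.logb (μ : ℝ) (Real.logb 2 (N : ℝ))⌉ ≤ (M : ℤ)) :
    (∃ S : PIRScheme (ZMod 2) N M (N * n ^ (M - 2)),
      S.IsLinear ∧ S.IsCapacityAchieving T ∧
      S.rate = (1 - (T : ℝ) / N) / (1 - ((T : ℝ) / N) ^ M)) ∧
    IsLeast (linearSubpacketizations N T M) (N * n ^ (M - 2)) := by
  obtain ⟨d, hd⟩ : ∃ d, d = Nat.gcd N T := ⟨_, rfl⟩
  rw [← hd] at hn ht
  have hd0 : 0 < d := hd ▸ Nat.gcd_pos_of_pos_right N hT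
  have hNd : N = d * n := by rw [hn, Nat.mul_div_cancel' (hd ▸ Nat.gcd_dvd_left N T)]
  have hTd : T = d * t := by rw [ht, Nat.mul_div_cancel' (hd ▸ Nat.gcd_dvd_right N T)]
  have hcop : t.Coprime n := by
    rw [hn, ht, hd]
    exact (Nat.coprime_div_gcd_div_gcd (hd ▸ hd0)).symm
  have hμt : μ ≤ t := hμ ▸ min_le_left _ _
  have hμn : μ ≤ n - t := hμ ▸ min_le_right _ _
  have ht0 : 0 < t := by omega
  have htn : t < n := by omega
  -- Both t and n - t are at least 2. Hence log₂ N > 1, the ceiling in the hypothesis is positive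
  -- and M ≥ 3.
  have hN4 : 4 ≤ N := by
    rw [hNd]
    exact (show 4 ≤ n by omega).trans (Nat.le_mul_of_pos_left n hd0)
  have hN4' : (4 : ℝ) ≤ N := by exact_mod_cast hN4
  have hlog2 : 1 < Real.logb 2 (N : ℝ) := by
    rw [Real.lt_logb_iff_rpow_lt (by norm_num) (by linarith)]
    norm_num
    linarith
  have hM3 : 3 ≤ M := by
    have : 0 < Real.logb (μ : ℝ) (Real.logb 2 (N : ℝ)) :=
      Real.logb_pos (by exact_mod_cast hμ1) hlog2
    have := Int.ceil_pos.2 this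
    omega
  have hNμ : N ≤ 2 ^ μ ^ (M - 2) := by
    refine le_two_pow_of_logb_le (by omega) hμ1 ?_
    have h1 : ⌈Real.logb (μ : ℝ) (Real.logb 2 (N : ℝ))⌉ ≤ ((M - 2 : ℕ) : ℤ) := by omega
    exact_mod_cast Int.ceil_le.1 h1
  have hL0 : 0 < N * n ^ (M - 2) := Nat.mul_pos (by omega) (pow_pos (by omega) _)
  have hM0 : 0 < M := by omega
  set G : ℝ := ∑ i ∈ range M, ((T : ℝ) / N) ^ i with hGdef
  have hx : (T : ℝ) / N = t / n := by
    rw [hTd, hNd]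
    push_cast
    exact mul_div_mul_left _ _ (by exact_mod_cast hd0.ne')
  have hn0 : (0 : ℝ) < n := by exact_mod_cast (by omega : 0 < n)
  have htn' : (t : ℝ) < n := by exact_mod_cast htn
  have hx1 : (T : ℝ) / N < 1 := by rw [hx, div_lt_one hn0]; exact htn'
  have hGgeom : G = (1 - ((T : ℝ) / N) ^ M) / (1 - (T : ℝ) / N) := by
    rw [hGdef, geom_sum_eq hx1.ne, ← neg_div_neg_eq, neg_sub, neg_sub]
  obtain ⟨S, hlin, hS, hrate⟩ : ∃ S : PIRScheme (ZMod 2) N M (N * n ^ (M - 2)),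
      S.IsLinear ∧ S.IsTPIR T ∧ S.rate = G⁻¹ := by
    have := exists_linear_scheme (d := d) ht0 htn (show 2 ≤ M by omega) fun k hk hkM => by
      rw [← hNd]
      exact hNμ.trans (Nat.pow_le_pow_right (by norm_num) (pow_le_blockSize hμt hμn hk hkM))
    rw [← hNd, ← hTd] at this
    obtain ⟨S, hlin, hS, hent⟩ := this
    refine ⟨S, hlin, hS, ?_⟩
    have hle := PIRScheme.mul_sum_pow_le_sum_entropy hS hT hTN.le hM0
    have hlog : 0 < Real.log 2 := Real.log_pos (by norm_num)
    have hLG : ((n : ℝ) - t) * ((N * n ^ (M - 2) : ℕ) * Real.log 2 * G) =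
        d * ((n : ℝ) ^ M - (t : ℝ) ^ M) * Real.log 2 := by
      rw [hGgeom, hx, hNd]
      obtain ⟨m, rfl⟩ : ∃ m, M = m + 2 := ⟨M - 2, by omega⟩
      have h1 : (n : ℝ) - t ≠ 0 := by linarith
      rw [Nat.add_sub_cancel, div_pow, one_sub_div hn0.ne', one_sub_div (pow_pos hn0 _).ne']
      push_cast
      field_simp
      ring
    rw [ZMod.card] at hle
    push_cast at hle
    -- The number of returned bits bounds the sum from above and the capacity bound from below, so
    -- no answer entropy has to be computed.
    have heq : ∑ j, entropy S.law (S.answer j) = (N * n ^ (M - 2) : ℕ) * Real.log 2 * G := by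
      refine le_antisymm (le_of_mul_le_mul_left (hent.trans_eq hLG.symm) (by linarith)) ?_
      push_cast
      exact hle
    have hL0' : ((N * n ^ (M - 2) : ℕ) : ℝ) * Real.log 2 ≠ 0 :=
      (mul_pos (by exact_mod_cast hL0) hlog).ne'
    rw [PIRScheme.rate, S.entropy_desired hM0, heq, ZMod.card]
    push_cast at hL0' ⊢
    rw [div_mul_eq_div_div, div_self hL0', one_div]
  have hmax : ∀ r ∈ achievableRates N T M, r ≤ G⁻¹ := by
    rintro r ⟨F, _, _, L, S', hL, hS', rfl⟩
    exact PIRScheme.rate_le hS' hT hTN.le hM0 hL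
  have hmem : G⁻¹ ∈ achievableRates N T M := ⟨ZMod 2, inferInstance, inferInstance, _, S, hL0, hS,
    hrate⟩
  have hcap : S.IsCapacityAchieving T := ⟨hS, by rw [hrate]; exact ⟨hmem, hmax⟩⟩
  refine ⟨⟨S, hlin, hcap, ?_⟩, ⟨hL0, ZMod 2, inferInstance, inferInstance, S, hlin, hcap⟩, ?_⟩
  · rw [hrate, hGgeom, inv_div]
  · rintro L ⟨hL, F, _, _, S', hlin', hS', hgreat⟩
    have hrate' : S'.rate = G⁻¹ := le_antisymm (hmax _ hgreat.1) (hgreat.2 hmem)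
    exact Nat.le_of_dvd hL (PIRScheme.mul_pow_dvd_of_isLinear hS' hlin' hd0 ht0 htn hcop hNd hTd
      (by omega) (PIRScheme.sum_entropy_eq_of_rate_eq hM0 hrate'))
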